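/- Let $G=(V,E,w)$ be a weighted hypergraph: $V$ is a finite set, $E\subset 2^V$ is a set of subsets of $V$ each having more than one element, and $w:E\to(0,\infty)$. Let $p\in[1,\infty)$ and let $|\cdot|$ and $\cdot$ be the Euclidean norm and inner product on $\mathbb R^V$. For $e\in E$ put $f_e(x)=\max_{u,v\in e}(x(u)-x(v))$, and let $$\varphi(x)=\frac1p\sum_{e\in E}w(e)f_e(x)^p,\qquad L_{G,p}(x)=\partial\varphi(x)=\{\eta\in\mathbb R^V:\ \eta\cdot(\xi-x)\le\varphi(\xi)-\varphi(x)\ \ \forall\xi\in\mathbb R^V\}.$$ For $x\in\mathbb R^V$ let $\overline x\in\mathbb R^V$ be the vector whose value at $v$ is the average of $x$ over the connected component of $v$ (the set of vertices joined to $v$ by a finite, possibly empty, chain of hyperedges). For a closed convex nonempty set $C\subset\mathbb R^V$ let $C^\circ$ be its unique element of least norm. **Theorem.** Let $T>0$, $x_0\in\mathbb R^V$ and $h\in L^2(0,T;\mathbb R^V)$. The Cauchy problem $$x'(t)+L_{G,p}(x(t))\ni h(t)\ \text{ for a.e. } t\in(0,T),\qquad x(0)=x_0,$$ has a unique strong solution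 $x$ (a function that is continuous on $[0,T]$, absolutely continuous on compact subintervals of $(0,T)$, and satisfies the inclusion a.e. and the initial condition). Moreover $x\in W^{1,2}(0,T;\mathbb R^V)$, the function $t\mapsto\varphi(x(t))$ is absolutely continuous on $[0,T]$, and for all $t\in[0,T]$ $$\Bigl(\int_0^t|x'(s)|^2ds\Bigr)^{1/2}\le\Bigl(\int_0^t|h(s)|^2ds\Bigr)^{1/2}+\sqrt{\varphi(x_0)}.$$ If $t_0\in[0,T)$ is a right-Lebesgue point of $h$, i.e. there is a vector $h(t_0+0)$ with $\lim_{\tau\to+0}\frac1\tau\int_{t_0}^{t_0+\tau}|h(s)-h(t_0+0)|\,ds=0$ (so that $h(t_0+0)=\lim_{\tau\to+0}\frac1\tau\int_{t_0}^{t_0+\tau}h(s)\,ds$), then $x$ is right-differentiable at $t_0$ and $$\frac{d^+x}{dt}(t_0)=\bigl(h(t_0+0)-L_{G,p}(x(t_0))\bigr)^\circ .$$ If $h\in W^{1,1}(0,T;\mathbb R^V)$ (identified with its absolutely continuous representative), then $t\,x'(t)\in L^\infty(0,T;\mathbb R^V)$, and for every $t\in(0,T)$ the solution is right-differentiable at $t$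 with $$\Bigl|\frac{d^+x}{dt}(t)\Bigr|\le|h(t)|+\frac1t|x_0-\overline{x_0}|+\frac1{t^2}\int_0^ts^2|h'(s)|\,ds+\frac{\sqrt2}{t}\Bigl(\int_0^ts|h'(s)|\,ds\Bigr)^{1/2}\Bigl(|x_0-\overline{x_0}|+\int_0^t|h(s)|\,ds\Bigr)^{1/2}.$$ -/

import Mathlib

open MeasureTheory Filter Set
open scoped Topology ENNReal

/-- A weighted hypergraph `(V, E, w)` on the vertex set `V`: a set `E ⊆ 2 ^ V` of hyperedges, each
with more than one element, and a positive weight on each hyperedge. -/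
structure WeightedHypergraph (V : Type*) where
  edges : Finset (Finset V)
  one_lt_card : ∀ e ∈ edges, 1 < e.card
  weight : edges → ℝ
  weight_pos : ∀ e, 0 < weight e

/-- `f_e(x) = max_{u, v ∈ e} (x(u) - x(v))` (a maximum over a finite set, nonempty whenever `e` is
a hyperedge). -/
noncomputable def edgeSpread {V : Type*} [Fintype V] (e : Finset V) (x : EuclideanSpace ℝ V) : ℝ :=
  ⨆ q : e × e, (x q.1 - x q.2)

/-- The subdifferential `∂φ(x)` of an everywhere finite functional on a real inner product space. -/
def subdifferential {H : Type*} [NormedAddCommGroup H] [InnerProductSpace ℝ H]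
    (φ : H → ℝ) (x : H) : Set H :=
  {η | ∀ ξ : H, inner ℝ η (ξ - x) ≤ φ ξ - φ x}

/-- `z = C°`: the point `z` is the unique element of `C` of least norm. -/
def IsMinimalElement {H : Type*} [NormedAddCommGroup H] (C : Set H) (z : H) : Prop :=
  z ∈ C ∧ ∀ y ∈ C, y ≠ z → ‖z‖ < ‖y‖

namespace WeightedHypergraph

variable {V : Type*} [Fintype V]

/-- `φ_{G,p}(x) = (1/p) ∑_{e ∈ E} w(e) f_e(x) ^ p`. -/
noncomputable def energy (G : WeightedHypergraph V) (p : ℝ) (x : EuclideanSpace ℝ V) : ℝ :=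
  (1 / p) * ∑ e : G.edges, G.weight e * edgeSpread (e : Finset V) x ^ p

/-- The hypergraph `p`-Laplacian `L_{G,p} = ∂φ_{G,p}`. -/
noncomputable def pLaplacian (G : WeightedHypergraph V) (p : ℝ) (x : EuclideanSpace ℝ V) :
    Set (EuclideanSpace ℝ V) :=
  subdifferential (G.energy p) x

/-- `u` and `v` are joined by a finite (possibly empty) chain of hyperedges. -/
def Reachable (G : WeightedHypergraph V) (u v : V) : Prop :=
  Relation.ReflTransGen (fun a b => ∃ e ∈ G.edges, a ∈ e ∧ b ∈ e) u v

open Classical in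
/-- The connected component of `v`. -/
noncomputable def component (G : WeightedHypergraph V) (v : V) : Finset V :=
  Finset.univ.filter (fun u => G.Reachable v u)

/-- `x̄`: each value of `x` is replaced by the average of `x` over the connected component. -/
noncomputable def average (G : WeightedHypergraph V) (x : EuclideanSpace ℝ V) :
    EuclideanSpace ℝ V :=
  WithLp.toLp 2 fun v => (1 / ((G.component v).card : ℝ)) * ∑ u ∈ G.component v, x u

/-- `x` is a (strong) solution on `[0, T]` of `x' + L_{G,p}(x) ∋ h`, `x(0) = x₀`: it is continuous
on `[0, T]`, absolutely continuous on the compact subintervals of `(0, T)` (hence differentiable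
almost everywhere), and satisfies the inclusion at almost every time and the initial condition. -/
structure IsSolution (G : WeightedHypergraph V) (p T : ℝ) (h : ℝ → EuclideanSpace ℝ V)
    (x₀ : EuclideanSpace ℝ V) (x : ℝ → EuclideanSpace ℝ V) : Prop where
  continuousOn : ContinuousOn x (Icc 0 T)
  absolutelyContinuous : ∀ a b : ℝ, 0 < a → a < b → b < T → AbsolutelyContinuousOnInterval x a b
  inclusion : ∀ᵐ t ∂(volume.restrict (Ioo 0 T)), h t - deriv x t ∈ G.pLaplacian p (x t)
  initial : x 0 = x₀

end WeightedHypergraph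

/-- `x ∈ W^{1,q}(0, T; H)` for finite-dimensional `H`, through the absolutely continuous
representative on `[0, T]`: `x` and its almost everywhere derivative are in `L^q`. -/
structure MemW1 {H : Type*} [NormedAddCommGroup H] [NormedSpace ℝ H] (q : ℝ≥0∞) (T : ℝ)
    (x : ℝ → H) : Prop where
  absolutelyContinuous : AbsolutelyContinuousOnInterval x 0 T
  memLp : MemLp x q (volume.restrict (Ioo 0 T))
  memLp_deriv : MemLp (deriv x) q (volume.restrict (Ioo 0 T))

/-- `t₀` is a right-Lebesgue point of `h` with value `l`: the averages of `‖h - l‖` over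
`(t₀, t₀ + τ)` tend to `0` as `τ → 0+`. -/
def IsRightLebesguePoint {H : Type*} [NormedAddCommGroup H] (h : ℝ → H) (t₀ : ℝ) (l : H) : Prop :=
  Tendsto (fun τ : ℝ => (1 / τ) * ∫ s in t₀..(t₀ + τ), ‖h s - l‖) (𝓝[>] 0) (𝓝 0)

/-!
# The Cauchy problem for the hypergraph `p`-Laplacian

The energy `φ = φ_{G,p}` is a continuous nonnegative functional on a finite-dimensional space that
has a subgradient at every point (`pLaplacian_nonempty`) and vanishes at the componentwise average
of any vector (`energy_average`). Nothing else about hypergraphs is used: the theorem holds for the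
gradient flow `x' + ∂φ(x) ∋ h` of every such `φ`.

*Estimates.* If `⟪w, w'⟫ ≤ k ‖w‖ + c` almost everywhere, then `‖w‖` grows at most by
`∫ k` up to an error of order `√c` (`norm_le_of_inner_deriv_le_of_pos`). With `c = 0` and the
monotonicity of `∂φ` this gives the contraction property `IsStrongSolution.norm_sub_le`, hence
uniqueness. With `c > 0` it controls approximate solutions.

*Existence.* Since `∂φ` is bounded over bounded sets, explicit Euler polygons for a selection of
`∂φ`, set to zero outside a large ball, never leave that ball (`exists_approximate_solution`) and
form a Cauchy sequence, although the selection need not even be measurable. The residual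
`y = x - x₀ - ∫ h` of the limit is Lipschitz, and the inclusion passes to the limit in terms of the
increments of `y` (`exists_weakInclusion`). In this form it holds at *every* time: it yields
`h - x' ∈ ∂φ(x)` wherever `y` and `∫ h` are differentiable with the expected derivatives, and says
that every limit of the difference quotients of `-y` from the right is a subgradient.

*Right derivative.* At a right-Lebesgue point with value `l`, let `ξ` be the point of `∂φ(x(t₀))`
nearest to `l`. Comparison with the constant solution for the right-hand side `ξ` bounds the
difference quotients of `x` by `‖l - ξ‖ + o(1)`. So their limit points lie in `l - ∂φ(x(t₀))` and
have norm at most `‖l - ξ‖`, which leaves only `l - ξ` (`WeakInclusion.exists_hasDerivWithinAt`).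

*Energy and smoothing.* The chain rule `(φ ∘ x)' = ⟪h - x', x'⟫` gives
`∫ ‖x'‖² + φ(x(t)) - φ(x₀) = ∫ ⟪h, x'⟫`, and with the weight `s` a bound for `∫ s ‖x'‖²` in terms of
`x₀`, `h` and `s h'` (`IsStrongSolution.integral_mul_norm_deriv_sq_le`). Comparing a solution with
its time shifts shows `‖x'(t)‖ ≤ ‖x'(s)‖ + ∫_s^t ‖h'‖`; integration of this in `s` with weight `s`
and Cauchy–Schwarz turn the weighted energy bound into the pointwise one
(`IsStrongSolution.norm_rightDeriv_le_smoothing`).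
-/

/-! ### Absolutely continuous functions -/

namespace AbsolutelyContinuousOnInterval

/-- A function whose increments are dominated by those of an absolutely continuous one, possibly
with values in another space, is absolutely continuous. -/
theorem of_dist_le {X Y : Type*} [PseudoMetricSpace X] [PseudoMetricSpace Y] {f : ℝ → X}
    {g : ℝ → Y} {a b K : ℝ} (hg : AbsolutelyContinuousOnInterval g a b)
    (hfg : ∀ s ∈ uIcc a b, ∀ t ∈ uIcc a b, dist (f s) (f t) ≤ K * dist (g s) (g t)) :
    AbsolutelyContinuousOnInterval f a b := by
  unfold AbsolutelyContinuousOnInterval at hg ⊢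
  refine squeeze_zero' (Eventually.of_forall fun E => Finset.sum_nonneg fun i _ => dist_nonneg) ?_
    (by simpa using hg.const_mul K)
  filter_upwards [mem_inf_of_right (mem_principal_self _)] with E hE
  rw [Finset.mul_sum]
  exact Finset.sum_le_sum fun i hi => hfg _ (hE.1 i hi).1 _ (hE.1 i hi).2

theorem prodMk {X Y : Type*} [PseudoMetricSpace X] [PseudoMetricSpace Y] {f : ℝ → X}
    {g : ℝ → Y} {a b : ℝ} (hf : AbsolutelyContinuousOnInterval f a b)
    (hg : AbsolutelyContinuousOnInterval g a b) :
    AbsolutelyContinuousOnInterval (fun t => (f t, g t)) a b := by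
  unfold AbsolutelyContinuousOnInterval at hf hg ⊢
  refine squeeze_zero (fun E => Finset.sum_nonneg fun i _ => dist_nonneg) (fun E => ?_)
    (by simpa using hf.add hg)
  rw [← Finset.sum_add_distrib]
  exact Finset.sum_le_sum fun i _ => max_le_add_of_nonneg dist_nonneg dist_nonneg

theorem const {X : Type*} [PseudoMetricSpace X] (c : X) (a b : ℝ) :
    AbsolutelyContinuousOnInterval (fun _ => c) a b :=
  ((LipschitzWith.const c).lipschitzOnWith (s := uIcc a b)).absolutelyContinuousOnInterval

theorem id (a b : ℝ) : AbsolutelyContinuousOnInterval (fun t : ℝ => t) a b :=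
  (LipschitzWith.id.lipschitzOnWith (s := uIcc a b)).absolutelyContinuousOnInterval

theorem lipschitzOnWith_comp {X Y : Type*} [PseudoMetricSpace X] [PseudoMetricSpace Y]
    {f : ℝ → X} {F : X → Y} {a b : ℝ} {K : NNReal} {S : Set X} (hF : LipschitzOnWith K F S)
    (hf : AbsolutelyContinuousOnInterval f a b) (hS : MapsTo f (uIcc a b) S) :
    AbsolutelyContinuousOnInterval (fun t => F (f t)) a b :=
  hf.of_dist_le (K := K) fun _ hs _ ht => hF.dist_le_mul _ (hS hs) _ (hS ht)

theorem real_inner {H : Type*} [NormedAddCommGroup H] [InnerProductSpace ℝ H] {f g : ℝ → H} {a b : ℝ}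
    (hf : AbsolutelyContinuousOnInterval f a b) (hg : AbsolutelyContinuousOnInterval g a b) :
    AbsolutelyContinuousOnInterval (fun t => inner ℝ (f t) (g t)) a b := by
  obtain ⟨C, hC⟩ := hf.exists_bound
  obtain ⟨D, hD⟩ := hg.exists_bound
  refine (hf.prodMk hg).of_dist_le (K := C + D) fun s hs t ht => ?_
  have e : inner ℝ (f s) (g s) - inner ℝ (f t) (g t)
      = inner ℝ (f s) (g s - g t) + inner ℝ (f s - f t) (g t) := by
    simp [inner_sub_left, inner_sub_right]
  have hC0 : 0 ≤ C := (norm_nonneg _).trans (hC s hs)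
  have hD0 : 0 ≤ D := (norm_nonneg _).trans (hD s hs)
  rw [Real.dist_eq, e, add_mul]
  refine (abs_add_le _ _).trans (add_le_add ?_ ?_)
  · refine (abs_real_inner_le_norm _ _).trans ?_
    rw [← dist_eq_norm]
    exact mul_le_mul (hC s hs) (le_max_right _ _) dist_nonneg hC0
  · refine (abs_real_inner_le_norm _ _).trans ?_
    rw [← dist_eq_norm, mul_comm]
    exact mul_le_mul (hD t ht) (le_max_left _ _) dist_nonneg hD0

theorem ae_differentiableAt_of_finiteDimensional {F : Type*} [NormedAddCommGroup F]
    [NormedSpace ℝ F] [FiniteDimensional ℝ F] {f : ℝ → F} {a b : ℝ} (hab : a ≤ b)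
    (hf : AbsolutelyContinuousOnInterval f a b) :
    ∀ᵐ t ∂volume.restrict (Ioo a b), DifferentiableAt ℝ f t := by
  rw [ae_restrict_iff' measurableSet_Ioo]
  filter_upwards [hf.boundedVariationOn.ae_differentiableAt_of_mem_uIcc] with t ht h
  exact ht (by rw [uIcc_of_le hab]; exact Ioo_subset_Icc_self h)

/-- A one-sided form of the fundamental theorem of calculus. -/
theorem sub_le_integral {f k : ℝ → ℝ} {a b : ℝ} (hab : a ≤ b)
    (hf : AbsolutelyContinuousOnInterval f a b) (hk : IntervalIntegrable k volume a b)
    (hle : ∀ᵐ t ∂volume.restrict (Ioo a b), deriv f t ≤ k t) :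
    f b - f a ≤ ∫ t in a..b, k t := by
  rw [← hf.integral_deriv_eq_sub]
  refine intervalIntegral.integral_mono_ae_restrict hab hf.intervalIntegrable_deriv hk ?_
  rwa [← Measure.restrict_congr_set Ioo_ae_eq_Icc]

end AbsolutelyContinuousOnInterval

theorem IntervalIntegrable.absolutelyContinuousOnInterval_integral {F : Type*}
    [NormedAddCommGroup F] [NormedSpace ℝ F] {f : ℝ → F} {a b : ℝ}
    (hf : IntervalIntegrable f volume a b) :
    AbsolutelyContinuousOnInterval (fun t => ∫ s in a..t, f s) a b := by
  refine (hf.norm.absolutelyContinuousOnInterval_intervalIntegral left_mem_uIcc).of_dist_le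
    (K := 1) fun s hs t ht => ?_
  have hs' : IntervalIntegrable f volume a s := hf.mono_set (uIcc_subset_uIcc left_mem_uIcc hs)
  have ht' : IntervalIntegrable f volume a t := hf.mono_set (uIcc_subset_uIcc left_mem_uIcc ht)
  rw [dist_eq_norm, dist_eq_norm, intervalIntegral.integral_interval_sub_left hs' ht',
    intervalIntegral.integral_interval_sub_left hs'.norm ht'.norm, one_mul]
  exact intervalIntegral.norm_integral_le_abs_integral_norm

/-- **Growth lemma.** Integration of `(‖w‖² + c)^(1/2)`, whose derivative is at most `k + √c`. The
square root is regularised by `c` because `‖w‖` may fail to be differentiable at zeros of `w`. -/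
theorem norm_le_of_inner_deriv_le_of_pos {H : Type*} [NormedAddCommGroup H]
    [InnerProductSpace ℝ H] [FiniteDimensional ℝ H] {w : ℝ → H} {k : ℝ → ℝ} {a b c : ℝ}
    (hab : a ≤ b) (hc : 0 < c) (hw : AbsolutelyContinuousOnInterval w a b)
    (hk : IntervalIntegrable k volume a b) (hk0 : ∀ t, 0 ≤ k t)
    (hle : ∀ᵐ t ∂volume.restrict (Ioo a b), inner ℝ (w t) (deriv w t) ≤ k t * ‖w t‖ + c) :
    ‖w b‖ ≤ ‖w a‖ + (∫ t in a..b, k t) + √c * (1 + (b - a)) := by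
  set N : ℝ → ℝ := fun t => √(‖w t‖ ^ 2 + c) with hN
  have hNpos : ∀ t, 0 < N t := fun t => by simp only [hN]; positivity
  have hNsq : ∀ t, N t ^ 2 = ‖w t‖ ^ 2 + c := fun t => Real.sq_sqrt (by positivity)
  have hwN : ∀ t, ‖w t‖ ≤ N t := fun t => Real.le_sqrt_of_sq_le (by linarith)
  have hcN : ∀ t, √c ≤ N t := fun t => Real.sqrt_le_sqrt (by nlinarith [sq_nonneg ‖w t‖])
  have hac : AbsolutelyContinuousOnInterval N a b := by
    refine hw.of_dist_le (K := 1) fun s _ t _ => ?_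
    rw [one_mul, Real.dist_eq, dist_eq_norm]
    have key : ∀ s t, N s - N t ≤ ‖w s - w t‖ := by
      intro s t
      have h1 : ‖w s‖ ≤ ‖w s - w t‖ + ‖w t‖ := by
        simpa using norm_add_le (w s - w t) (w t)
      have h2 : N s ≤ N t + ‖w s - w t‖ := by
        refine Real.sqrt_le_iff.2 ⟨by positivity [hNpos t], ?_⟩
        nlinarith [hNsq t, hwN t, norm_nonneg (w s), norm_nonneg (w s - w t), norm_nonneg (w t),
          mul_le_mul_of_nonneg_left (hwN t) (norm_nonneg (w s - w t))]
      linarith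
    rw [abs_le]
    constructor
    · have := key t s
      rw [norm_sub_rev] at this
      linarith
    · exact key s t
  have hder : ∀ᵐ t ∂volume.restrict (Ioo a b), deriv N t ≤ k t + √c := by
    filter_upwards [hle, hw.ae_differentiableAt_of_finiteDimensional hab] with t ht hd
    have h1 : HasDerivAt N ((2 * inner ℝ (w t) (deriv w t)) / (2 * N t)) t :=
      (hd.hasDerivAt.norm_sq.add_const c).sqrt (by positivity)
    rw [h1.deriv, mul_div_mul_left _ _ two_ne_zero, div_le_iff₀ (hNpos t)]
    have hcc : √c * √c = c := Real.mul_self_sqrt hc.le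
    nlinarith [mul_le_mul_of_nonneg_left (hwN t) (hk0 t),
      mul_le_mul_of_nonneg_left (hcN t) (Real.sqrt_nonneg c)]
  have hfin := hac.sub_le_integral hab (hk.add intervalIntegrable_const) hder
  rw [intervalIntegral.integral_add hk intervalIntegrable_const, intervalIntegral.integral_const,
    smul_eq_mul] at hfin
  have hNa : N a ≤ ‖w a‖ + √c := by
    refine Real.sqrt_le_iff.2 ⟨by positivity, ?_⟩
    nlinarith [Real.sq_sqrt hc.le, Real.sqrt_nonneg c, norm_nonneg (w a),
      mul_nonneg (norm_nonneg (w a)) (Real.sqrt_nonneg c)]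
  nlinarith [hwN b]

theorem norm_le_of_inner_deriv_le {H : Type*} [NormedAddCommGroup H]
    [InnerProductSpace ℝ H] [FiniteDimensional ℝ H] {w : ℝ → H} {k : ℝ → ℝ} {a b : ℝ}
    (hab : a ≤ b) (hw : AbsolutelyContinuousOnInterval w a b)
    (hk : IntervalIntegrable k volume a b) (hk0 : ∀ t, 0 ≤ k t)
    (hle : ∀ᵐ t ∂volume.restrict (Ioo a b), inner ℝ (w t) (deriv w t) ≤ k t * ‖w t‖) :
    ‖w b‖ ≤ ‖w a‖ + ∫ t in a..b, k t := by
  have hlim : Tendsto (fun c : ℝ => ‖w a‖ + (∫ t in a..b, k t) + √c * (1 + (b - a))) (𝓝[>] 0)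
      (𝓝 (‖w a‖ + (∫ t in a..b, k t) + √0 * (1 + (b - a)))) := by
    apply Tendsto.mono_left _ nhdsWithin_le_nhds
    exact Continuous.tendsto (by fun_prop) 0
  have := ge_of_tendsto hlim (b := ‖w b‖) <| by
    filter_upwards [self_mem_nhdsWithin] with c hc
    refine norm_le_of_inner_deriv_le_of_pos hab hc hw hk hk0 ?_
    filter_upwards [hle] with t ht
    have : (0 : ℝ) < c := hc
    linarith
  simpa using this

/-! ### Subdifferentials of continuous functionals -/

section Subdifferential

variable {H : Type*} [NormedAddCommGroup H] [InnerProductSpace ℝ H] {φ : H → ℝ}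

theorem subdifferential_monotone {x y ξ η : H} (hξ : ξ ∈ subdifferential φ x)
    (hη : η ∈ subdifferential φ y) : 0 ≤ inner ℝ (ξ - η) (x - y) := by
  have h1 := hξ y
  have h2 := hη x
  have e : inner ℝ (ξ - η) (x - y) = -inner ℝ ξ (y - x) - inner ℝ η (x - y) := by
    rw [inner_sub_left, ← neg_sub y x, inner_neg_right, inner_neg_right]
  linarith

theorem convex_subdifferential (x : H) : Convex ℝ (subdifferential φ x) := by
  intro ξ hξ η hη a b ha hb hab ζ
  rw [inner_add_left, inner_smul_left, inner_smul_left]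
  have h1 := mul_le_mul_of_nonneg_left (hξ ζ) ha
  have h2 := mul_le_mul_of_nonneg_left (hη ζ) hb
  have h3 : φ ζ - φ x = a * (φ ζ - φ x) + b * (φ ζ - φ x) := by rw [← add_mul, hab, one_mul]
  simp only [conj_trivial]
  linarith

theorem isClosed_subdifferential (x : H) : IsClosed (subdifferential φ x) := by
  simp only [subdifferential, ofPred_forall]
  exact isClosed_iInter fun ξ => isClosed_le (by fun_prop) continuous_const

/-- Subgradients of a continuous functional are bounded over bounded sets: test the subgradient
inequality at the point at distance one in the direction of the subgradient. -/
theorem exists_norm_le_of_mem_subdifferential [FiniteDimensional ℝ H] (hφ : Continuous φ)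
    (R : ℝ) : ∃ L, 0 ≤ L ∧ ∀ x, ‖x‖ ≤ R → ∀ η ∈ subdifferential φ x, ‖η‖ ≤ L := by
  obtain ⟨C, hC⟩ := (isCompact_closedBall (0 : H) (R + 1)).exists_bound_of_continuousOn
    hφ.continuousOn
  simp only [mem_closedBall_zero_iff, Real.norm_eq_abs] at hC
  refine ⟨max 0 (2 * C), le_max_left _ _, fun x hx η hη => ?_⟩
  rcases eq_or_ne η 0 with rfl | hne
  · simp
  have hpos : 0 < ‖η‖ := norm_pos_iff.2 hne
  have h1 := hη (x + ‖η‖⁻¹ • η)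
  rw [add_sub_cancel_left, inner_smul_right, real_inner_self_eq_norm_sq] at h1
  have e : ‖η‖⁻¹ * ‖η‖ ^ 2 = ‖η‖ := by field_simp
  have h2 : ‖x + ‖η‖⁻¹ • η‖ ≤ R + 1 := by
    refine (norm_add_le _ _).trans (add_le_add hx ?_)
    rw [norm_smul, norm_inv, norm_norm, inv_mul_cancel₀ hpos.ne']
  have h3 := abs_le.1 (hC _ h2)
  have h4 := abs_le.1 (hC x (by linarith))
  rw [e] at h1
  exact le_max_of_le_right (by linarith)

theorem exists_lipschitzOnWith_of_subdifferential_nonempty [FiniteDimensional ℝ H]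
    (hφ : Continuous φ) (hne : ∀ x, (subdifferential φ x).Nonempty) (R : ℝ) :
    ∃ K : NNReal, LipschitzOnWith K φ (Metric.closedBall 0 R) := by
  obtain ⟨L, hL0, hL⟩ := exists_norm_le_of_mem_subdifferential hφ R
  refine ⟨L.toNNReal, LipschitzOnWith.of_dist_le_mul fun x hx y hy => ?_⟩
  have key : ∀ x y : H, ‖y‖ ≤ R → φ y - φ x ≤ L * ‖x - y‖ := by
    intro x y hy
    obtain ⟨η, hη⟩ := hne y
    have h1 := hη x
    have h2 := abs_le.1 (abs_real_inner_le_norm η (x - y))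
    have h3 := mul_le_mul_of_nonneg_right (hL y hy η hη) (norm_nonneg (x - y))
    linarith
  rw [mem_closedBall_zero_iff] at hx hy
  rw [Real.dist_eq, dist_eq_norm, abs_le, Real.coe_toNNReal L hL0]
  have h1 := key x y hy
  have h2 := key y x hx
  rw [norm_sub_rev] at h2
  exact ⟨by linarith, h2⟩

/-- **Chain rule.** A subgradient at `x t` determines the derivative of `φ ∘ x` wherever that
derivative exists, because `φ ∘ x - ⟪η, x⟫` has a minimum at `t`. -/
theorem deriv_comp_eq_inner_of_mem_subdifferential {x : ℝ → H} {t : ℝ} {η : H}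
    (hη : η ∈ subdifferential φ (x t)) (hx : DifferentiableAt ℝ x t)
    (hφx : DifferentiableAt ℝ (fun s => φ (x s)) t) :
    deriv (fun s => φ (x s)) t = inner ℝ η (deriv x t) := by
  have hmin : IsLocalMin (fun s => φ (x s) - inner ℝ η (x s)) t := by
    refine Eventually.of_forall fun s => ?_
    have := hη (x s)
    rw [inner_sub_right] at this
    simp only
    linarith
  have hd : HasDerivAt (fun s => φ (x s) - inner ℝ η (x s))
      (deriv (fun s => φ (x s)) t - inner ℝ η (deriv x t)) t := by
    refine hφx.hasDerivAt.sub ?_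
    simpa using (hasDerivAt_const t η).inner ℝ hx.hasDerivAt
  linarith [hmin.hasDerivAt_eq_zero hd]

end Subdifferential

/-! ### The explicit Euler scheme -/

section Euler

variable {H : Type*} [NormedAddCommGroup H] [InnerProductSpace ℝ H] [FiniteDimensional ℝ H]

/-- The values at the grid points `k δ` of the explicit Euler scheme for `x' = h - G x`, where
`P` is a primitive of `h`. -/
noncomputable def eulerNode (G : H → H) (P : ℝ → H) (x₀ : H) (δ : ℝ) : ℕ → H
  | 0 => x₀
  | k + 1 => eulerNode G P x₀ δ k + (P ((k + 1 : ℕ) * δ) - P (k * δ))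
      - δ • G (eulerNode G P x₀ δ k)

/-- The piecewise constant interpolation of the Euler scheme. -/
noncomputable def eulerStep (G : H → H) (P : ℝ → H) (x₀ : H) (δ : ℝ) (t : ℝ) : H :=
  eulerNode G P x₀ δ ⌊t / δ⌋₊

variable {G : H → H} {P : ℝ → H} {x₀ : H} {δ L T : ℝ}

theorem intervalIntegrable_eulerStep (hG : ∀ a, ‖G a‖ ≤ L) (a b : ℝ) :
    IntervalIntegrable (fun s => G (eulerStep G P x₀ δ s)) volume a b := by
  have hm : StronglyMeasurable (fun s => G (eulerStep G P x₀ δ s)) := by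
    borelize H
    refine Measurable.stronglyMeasurable ?_
    exact (measurable_from_nat (f := fun k => G (eulerNode G P x₀ δ k))).comp
      (Nat.measurable_floor.comp (measurable_id.div_const δ))
  rw [intervalIntegrable_iff]
  exact Measure.integrableOn_of_bounded (M := L) (by simp) hm.aestronglyMeasurable
    (Eventually.of_forall fun s => hG _)

theorem integral_eulerStep (hδ : 0 < δ) (k : ℕ) {t : ℝ} (ht : k * δ ≤ t)
    (ht' : t ≤ (k + 1) * δ) :
    ∫ s in (k * δ)..t, G (eulerStep G P x₀ δ s) = (t - k * δ) • G (eulerNode G P x₀ δ k) := by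
  rw [← intervalIntegral.integral_const]
  refine intervalIntegral.integral_congr_ae ?_
  filter_upwards [compl_mem_ae_iff.2 (measure_singleton ((k + 1) * δ))] with s hs hst
  rw [uIoc_of_le ht] at hst
  have hlt : s < (k + 1) * δ := lt_of_le_of_ne (hst.2.trans ht') hs
  have : ⌊s / δ⌋₊ = k := by
    rw [Nat.floor_eq_iff (div_nonneg ((by positivity : 0 ≤ k * δ).trans hst.1.le) hδ.le),
      le_div_iff₀ hδ, div_lt_iff₀ hδ]
    exact ⟨hst.1.le, hlt⟩
  rw [eulerStep, this]

theorem eulerNode_eq (hG : ∀ a, ‖G a‖ ≤ L) (hδ : 0 < δ) (hP : P 0 = 0) (k : ℕ) :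
    eulerNode G P x₀ δ k = x₀ + P (k * δ) - ∫ s in 0..(k * δ), G (eulerStep G P x₀ δ s) := by
  induction k with
  | zero => simp [eulerNode, hP]
  | succ k ih =>
    rw [← intervalIntegral.integral_add_adjacent_intervals (b := k * δ)
      (intervalIntegrable_eulerStep hG _ _) (intervalIntegrable_eulerStep hG _ _),
      integral_eulerStep hδ k (by push_cast; nlinarith) (by push_cast; rfl), eulerNode]
    have : ((k + 1 : ℕ) : ℝ) * δ - k * δ = δ := by push_cast; ring
    rw [this]
    nth_rewrite 1 [ih]
    abel

/-- For a bounded, not necessarily measurable, field `G`, the Euler scheme solves `x' = h - G x`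
with the argument of `G` displaced by at most `ε`. -/
theorem exists_euler_approximation (hG : ∀ a, ‖G a‖ ≤ L) (hP : P 0 = 0)
    (hPc : ContinuousOn P (Icc 0 T)) (x₀ : H) {ε : ℝ} (hε : 0 < ε) :
    ∃ u : ℝ → H, (∀ a b, IntervalIntegrable (fun s => G (u s)) volume a b) ∧
      ∀ t ∈ Icc 0 T, ‖x₀ + P t - (∫ s in 0..t, G (u s)) - u t‖ ≤ ε := by
  have hL : 0 ≤ L := (norm_nonneg _).trans (hG 0)
  obtain ⟨δ₀, hδ₀, hPδ⟩ := Metric.uniformContinuousOn_iff.1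
    (isCompact_Icc.uniformContinuousOn_of_continuous hPc) (ε / 2) (half_pos hε)
  set δ := min (δ₀ / 2) (ε / (2 * (L + 1))) with hδdef
  have hδ : 0 < δ := lt_min (half_pos hδ₀) (by positivity)
  have hδ1 : δ < δ₀ := (min_le_left _ _).trans_lt (half_lt_self hδ₀)
  have hδ2 : δ * L ≤ ε / 2 := by
    have h1 : δ * (2 * (L + 1)) ≤ ε := (le_div_iff₀ (by positivity)).1 (min_le_right _ _)
    nlinarith
  refine ⟨eulerStep G P x₀ δ, intervalIntegrable_eulerStep hG, fun t ht => ?_⟩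
  set k := ⌊t / δ⌋₊ with hk
  have hk1 : k * δ ≤ t := (le_div_iff₀ hδ).1 (Nat.floor_le (div_nonneg ht.1 hδ.le))
  have hk2 : t < (k + 1) * δ := (div_lt_iff₀ hδ).1 (Nat.lt_floor_add_one _)
  have hstep : eulerStep G P x₀ δ t = eulerNode G P x₀ δ k := rfl
  have e : x₀ + P t - (∫ s in 0..t, G (eulerStep G P x₀ δ s)) - eulerStep G P x₀ δ t
      = (P t - P (k * δ)) - (t - k * δ) • G (eulerNode G P x₀ δ k) := by
    rw [hstep, ← integral_eulerStep hδ k hk1 hk2.le,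
      ← intervalIntegral.integral_add_adjacent_intervals (b := k * δ)
      (intervalIntegrable_eulerStep hG _ _) (intervalIntegrable_eulerStep hG _ _)]
    rw [eulerNode_eq hG hδ hP k]
    abel
  rw [e]
  have h1 : ‖P t - P (k * δ)‖ ≤ ε / 2 := by
    rw [← dist_eq_norm]
    refine (hPδ t ht (k * δ) ⟨by positivity, hk1.trans ht.2⟩ ?_).le
    rw [Real.dist_eq, abs_of_nonneg (by linarith)]
    linarith
  have h2 : ‖(t - k * δ) • G (eulerNode G P x₀ δ k)‖ ≤ ε / 2 := by
    rw [norm_smul, Real.norm_of_nonneg (by linarith)]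
    refine le_trans ?_ hδ2
    exact mul_le_mul (by linarith) (hG _) (norm_nonneg _) hδ.le
  linarith [norm_sub_le (P t - P (k * δ)) ((t - k * δ) • G (eulerNode G P x₀ δ k))]

end Euler

/-! ### Existence in a weak form -/

theorem IntervalIntegrable.ae_hasDerivAt_integral_restrict_Ioo {F : Type*} [NormedAddCommGroup F]
    [NormedSpace ℝ F] [CompleteSpace F] {f : ℝ → F} {a b : ℝ} (hab : a ≤ b)
    (hf : IntervalIntegrable f volume a b) :
    ∀ᵐ t ∂volume.restrict (Ioo a b), HasDerivAt (fun t => ∫ s in a..t, f s) (f t) t := by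
  rw [ae_restrict_iff' measurableSet_Ioo]
  filter_upwards [hf.ae_hasDerivAt_integral] with t ht htab
  exact ht (by rw [uIcc_of_le hab]; exact Ioo_subset_Icc_self htab) a left_mem_uIcc

theorem ae_restrict_Ioo_mono {a b c d : ℝ} {q : ℝ → Prop} (hac : a ≤ c) (hdb : d ≤ b)
    (hq : ∀ᵐ t ∂volume.restrict (Ioo a b), q t) : ∀ᵐ t ∂volume.restrict (Ioo c d), q t :=
  ae_restrict_of_ae_restrict_of_subset (Ioo_subset_Ioo hac hdb) hq

section Existence

variable {H : Type*} [NormedAddCommGroup H] [InnerProductSpace ℝ H] [FiniteDimensional ℝ H]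
  {φ : H → ℝ} {T : ℝ} {h : ℝ → H} {z : H}

/-- Approximate solutions of `x' + ∂φ(x) ∋ h` with subgradients bounded independently of the
accuracy. The scheme is run with a selection of `∂φ` replaced by `0` outside a large ball; the
monotonicity of `∂φ` at the minimiser `z` shows that the ball is never left. -/
theorem exists_approximate_solution (hφ : Continuous φ) (hz : ∀ x, φ z ≤ φ x)
    (hne : ∀ x, (subdifferential φ x).Nonempty) (hT : 0 < T)
    (hh : IntervalIntegrable h volume 0 T) (x₀ : H) :
    ∃ L, 0 < L ∧ ∀ ε > 0, ∃ u η : ℝ → H, (∀ a b, IntervalIntegrable η volume a b) ∧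
      (∀ t ∈ Icc 0 T, η t ∈ subdifferential φ (u t) ∧ ‖η t‖ ≤ L) ∧
      ∀ t ∈ Icc 0 T, ‖x₀ + (∫ s in 0..t, h s) - (∫ s in 0..t, η s) - u t‖ ≤ ε := by
  classical
  choose g hg using hne
  set R := ‖x₀ - z‖ + (∫ s in 0..T, ‖h s‖) + 1 with hR
  obtain ⟨L₀, hL₀, hL₀'⟩ := exists_norm_le_of_mem_subdifferential hφ (‖z‖ + R)
  set L := L₀ + 1 with hLdef
  have hL : 0 < L := by positivity
  set G : H → H := fun a => if ‖a - z‖ ≤ R then g a else 0 with hGdef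
  have hGL : ∀ a, ‖G a‖ ≤ L := by
    intro a
    by_cases ha : ‖a - z‖ ≤ R
    · simp only [hGdef, if_pos ha]
      refine (hL₀' a ?_ _ (hg a)).trans (by linarith)
      have := norm_add_le z (a - z)
      rw [add_sub_cancel] at this
      linarith
    · simp only [hGdef, if_neg ha, norm_zero]
      exact hL.le
  refine ⟨L, hL, fun ε hε => ?_⟩
  -- `ε'` is so small that the error `√(ε' L) (1 + T) + ε'` fits into the summand `1` of `R`
  set κ : ℝ := 1 / (2 * (1 + T)) with hκ
  have hκ0 : 0 < κ := by positivity
  set ε' := min (min ε (1 / 2)) (κ ^ 2 / L) with hε'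
  have hε'0 : 0 < ε' := lt_min (lt_min hε (by norm_num)) (by positivity)
  have hε'1 : ε' ≤ ε := (min_le_left _ _).trans (min_le_left _ _)
  have hε'2 : ε' ≤ 1 / 2 := (min_le_left _ _).trans (min_le_right _ _)
  have hε'3 : ε' * L ≤ κ ^ 2 := (le_div_iff₀ hL).1 (min_le_right _ _)
  have hPac := hh.absolutelyContinuousOnInterval_integral
  have hPc : ContinuousOn (fun t => ∫ s in 0..t, h s) (Icc 0 T) := by
    simpa [uIcc_of_le hT.le] using hPac.continuousOn
  obtain ⟨u, hu, hu'⟩ := exists_euler_approximation hGL (by simp) hPc x₀ hε'0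
  have hball : ∀ t ∈ Icc 0 T, ‖u t - z‖ ≤ R := by
    intro t ht
    set w : ℝ → H := fun t => x₀ + (∫ s in 0..t, h s) - (∫ s in 0..t, G (u s)) - z with hw
    have hht : IntervalIntegrable h volume 0 t :=
      hh.mono_set (uIcc_subset_uIcc left_mem_uIcc (by rwa [uIcc_of_le hT.le]))
    have hwac : AbsolutelyContinuousOnInterval w 0 t :=
      (((AbsolutelyContinuousOnInterval.const x₀ 0 t).fun_add
        hht.absolutelyContinuousOnInterval_integral).fun_sub
        (hu 0 t).absolutelyContinuousOnInterval_integral).fun_sub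
        (AbsolutelyContinuousOnInterval.const z 0 t)
    have hder : ∀ᵐ s ∂volume.restrict (Ioo 0 t),
        inner ℝ (w s) (deriv w s) ≤ ‖h s‖ * ‖w s‖ + ε' * L := by
      filter_upwards [hht.ae_hasDerivAt_integral_restrict_Ioo ht.1,
        (hu 0 t).ae_hasDerivAt_integral_restrict_Ioo ht.1, ae_restrict_mem measurableSet_Ioo]
        with s h1 h2 hs
      have hd : HasDerivAt w (h s - G (u s)) s := ((h1.const_add x₀).sub h2).sub_const z
      have hws : ‖w s - (u s - z)‖ ≤ ε' := by
        have := hu' s ⟨hs.1.le, hs.2.le.trans ht.2⟩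
        rwa [show w s - (u s - z) = x₀ + (∫ s in 0..s, h s) - (∫ s in 0..s, G (u s)) - u s by
          simp only [hw]; abel]
      rw [hd.deriv, inner_sub_right]
      have e1 : inner ℝ (w s) (h s) ≤ ‖h s‖ * ‖w s‖ := by
        rw [mul_comm]; exact real_inner_le_norm _ _
      have e2 : -inner ℝ (w s) (G (u s)) ≤ ε' * L := by
        by_cases hus : ‖u s - z‖ ≤ R
        · have h3 : G (u s) = g (u s) := if_pos hus
          have h4 := hg (u s) z
          rw [← h3] at h4
          have h5 := abs_le.1 (abs_real_inner_le_norm (w s - (u s - z)) (G (u s)))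
          have h6 : inner ℝ (w s) (G (u s))
              = inner ℝ (w s - (u s - z)) (G (u s)) - inner ℝ (G (u s)) (z - u s) := by
            rw [real_inner_comm (z - u s), ← inner_sub_left]
            congr 1
            abel
          have h7 := mul_le_mul hws (hGL (u s)) (norm_nonneg _) hε'0.le
          linarith [hz (u s)]
        · have h3 : G (u s) = 0 := if_neg hus
          rw [h3, inner_zero_right, neg_zero]
          positivity
      linarith
    have hgrow := norm_le_of_inner_deriv_le_of_pos ht.1 (by positivity) hwac hht.norm
      (fun s => norm_nonneg _) hder
    have hw0 : w 0 = x₀ - z := by simp [hw]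
    have hsq : √(ε' * L) * (1 + (t - 0)) ≤ 1 / 2 := by
      have h1 : √(ε' * L) ≤ κ := Real.sqrt_le_iff.2 ⟨hκ0.le, hε'3⟩
      have h2 : κ * (1 + T) = 1 / 2 := by rw [hκ]; field_simp
      have h3 := mul_le_mul h1 (show 1 + (t - 0) ≤ 1 + T by linarith [ht.2])
        (by linarith [ht.1]) hκ0.le
      linarith
    have hint : ∫ s in 0..t, ‖h s‖ ≤ ∫ s in 0..T, ‖h s‖ :=
      intervalIntegral.integral_mono_interval le_rfl ht.1 ht.2
        (Eventually.of_forall fun s => norm_nonneg _) hh.norm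
    have h1 : ‖u t - z‖ ≤ ‖w t‖ + ε' := by
      have e : u t - z = w t - (x₀ + (∫ s in 0..t, h s) - (∫ s in 0..t, G (u s)) - u t) := by
        simp only [hw]; abel
      rw [e]
      exact (norm_sub_le _ _).trans (by linarith [hu' t ht])
    rw [hw0] at hgrow
    linarith
  refine ⟨u, fun s => G (u s), hu, fun t ht => ⟨?_, hGL _⟩, fun t ht => (hu' t ht).trans hε'1⟩
  simp only [hGdef, if_pos (hball t ht)]
  exact hg (u t)

/-- The inclusion `-y' ∈ ∂φ(x)`, written with increments of `y` in place of its derivative, at every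
time `t₀` of `[0, T]`: the subgradient inequality for `y s - y t` holds up to `ε (t - s)` as soon as
`s ≤ t` are close to `t₀`. It is used for `x = x₀ + ∫ h + y`, where it stands for `x' + ∂φ(x) ∋ h`.
The two functions are kept separate, so that `x` and `y` are not tied to a particular `h`. -/
def WeakInclusion (φ : H → ℝ) (T : ℝ) (x y : ℝ → H) : Prop :=
  ∀ t₀ ∈ Icc 0 T, ∀ ξ, ∀ ε > 0, ∃ δ > 0, ∀ s ∈ Icc 0 T, ∀ t ∈ Icc 0 T, |s - t₀| < δ →
    |t - t₀| < δ → s ≤ t → inner ℝ (y s - y t) (ξ - x t₀) ≤ (φ ξ - φ (x t₀) + ε) * (t - s)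

/-- Two approximate solutions of accuracies `ε` and `ε'` stay at a distance of order `√(ε + ε')`, by
the monotonicity of `∂φ` and the growth lemma. -/
theorem norm_sub_le_of_approximate_solution {u v η ζ : ℝ → H} {L ε ε' : ℝ} {x₀ : H} (hL : 0 < L)
    (hε : 0 < ε) (hε' : 0 < ε')
    (hη : ∀ a b, IntervalIntegrable η volume a b) (hζ : ∀ a b, IntervalIntegrable ζ volume a b)
    (hη' : ∀ t ∈ Icc 0 T, η t ∈ subdifferential φ (u t) ∧ ‖η t‖ ≤ L)
    (hζ' : ∀ t ∈ Icc 0 T, ζ t ∈ subdifferential φ (v t) ∧ ‖ζ t‖ ≤ L)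
    (hu : ∀ t ∈ Icc 0 T, ‖x₀ + (∫ s in 0..t, h s) - (∫ s in 0..t, η s) - u t‖ ≤ ε)
    (hv : ∀ t ∈ Icc 0 T, ‖x₀ + (∫ s in 0..t, h s) - (∫ s in 0..t, ζ s) - v t‖ ≤ ε')
    {t : ℝ} (ht : t ∈ Icc 0 T) :
    ‖(∫ s in 0..t, η s) - ∫ s in 0..t, ζ s‖ ≤ √((ε + ε') * (2 * L)) * (1 + T) := by
  set w : ℝ → H := fun t => (∫ s in 0..t, η s) - ∫ s in 0..t, ζ s with hw
  have hwac : AbsolutelyContinuousOnInterval w 0 t :=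
    (hη 0 t).absolutelyContinuousOnInterval_integral.fun_sub
      (hζ 0 t).absolutelyContinuousOnInterval_integral
  have hder : ∀ᵐ s ∂volume.restrict (Ioo 0 t),
      inner ℝ (w s) (deriv w s) ≤ 0 * ‖w s‖ + (ε + ε') * (2 * L) := by
    filter_upwards [(hη 0 t).ae_hasDerivAt_integral_restrict_Ioo ht.1,
      (hζ 0 t).ae_hasDerivAt_integral_restrict_Ioo ht.1, ae_restrict_mem measurableSet_Ioo]
      with s h1 h2 hs
    have hs' : s ∈ Icc 0 T := ⟨hs.1.le, hs.2.le.trans ht.2⟩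
    have hd : HasDerivAt w (η s - ζ s) s := h1.sub h2
    rw [hd.deriv]
    have hm := subdifferential_monotone (hη' s hs').1 (hζ' s hs').1
    have e : w s + (u s - v s) = (x₀ + (∫ s in 0..s, h s) - (∫ s in 0..s, ζ s) - v s)
        - (x₀ + (∫ s in 0..s, h s) - (∫ s in 0..s, η s) - u s) := by
      simp only [hw]; abel
    have h3 : ‖w s + (u s - v s)‖ ≤ ε + ε' := by
      rw [e]
      exact (norm_sub_le _ _).trans (by linarith [hu s hs', hv s hs'])
    have h4 : ‖η s - ζ s‖ ≤ 2 * L :=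
      (norm_sub_le _ _).trans (by linarith [(hη' s hs').2, (hζ' s hs').2])
    have h5 : inner ℝ (w s) (η s - ζ s)
        = inner ℝ (w s + (u s - v s)) (η s - ζ s) - inner ℝ (η s - ζ s) (u s - v s) := by
      rw [real_inner_comm (u s - v s), ← inner_sub_left, add_sub_cancel_right]
    have h6 := mul_le_mul h3 h4 (norm_nonneg _) (by positivity)
    linarith [real_inner_le_norm (w s + (u s - v s)) (η s - ζ s)]
  have hgrow := norm_le_of_inner_deriv_le_of_pos ht.1 (by positivity) hwac
    (intervalIntegrable_const (c := (0 : ℝ))) (fun s => le_rfl) hder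
  have hw0 : w 0 = 0 := by simp [hw]
  rw [hw0] at hgrow
  simp only [norm_zero, intervalIntegral.integral_zero, add_zero, zero_add, sub_zero] at hgrow
  exact hgrow.trans (mul_le_mul_of_nonneg_left (by linarith [ht.2]) (Real.sqrt_nonneg _))

/-- Existence for the Cauchy problem in a weak form: the residual `y = x - x₀ - ∫ h` is Lipschitz
and satisfies the inclusion in terms of increments. -/
theorem exists_weakInclusion (hφ : Continuous φ) (hz : ∀ x, φ z ≤ φ x)
    (hne : ∀ x, (subdifferential φ x).Nonempty) (hT : 0 < T)
    (hh : IntervalIntegrable h volume 0 T) (x₀ : H) :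
    ∃ (y : ℝ → H) (L : NNReal), y 0 = 0 ∧ LipschitzOnWith L y (Icc 0 T) ∧
      WeakInclusion φ T (fun t => x₀ + (∫ s in 0..t, h s) + y t) y := by
  obtain ⟨L, hL, happ⟩ := exists_approximate_solution hφ hz hne hT hh x₀
  set e : ℕ → ℝ := fun n => 1 / ((n : ℝ) + 1) with he
  have he0 : ∀ n, 0 < e n := fun n => by simp only [he]; positivity
  have helim : Tendsto e atTop (𝓝 0) := tendsto_one_div_add_atTop_nhds_zero_nat
  have hanti : ∀ m n, m ≤ n → e n ≤ e m := fun m n hmn => one_div_le_one_div_of_le (by positivity)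
    (by simpa using hmn)
  choose u η hη hη' hu using fun n => happ (e n) (he0 n)
  set r : ℕ → ℝ := fun n => √((e n + e n) * (2 * L)) * (1 + T) with hr
  have hrlim : Tendsto r atTop (𝓝 0) := by
    have h1 : Tendsto r atTop (𝓝 (√((0 + 0) * (2 * L)) * (1 + T))) :=
      (((helim.add helim).mul_const (2 * L)).sqrt).mul_const (1 + T)
    simpa using h1
  set Y : ℕ → ℝ → H := fun n t => -∫ s in 0..t, η n s with hY
  have hdist : ∀ t ∈ Icc 0 T, ∀ m n N, N ≤ m → N ≤ n → dist (Y m t) (Y n t) ≤ r N := by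
    intro t ht m n N hm hn
    rw [dist_eq_norm, hY, neg_sub_neg]
    refine (norm_sub_le_of_approximate_solution hL (he0 n) (he0 m) (hη n) (hη m) (hη' n) (hη' m)
      (hu n) (hu m) ht).trans ?_
    refine mul_le_mul_of_nonneg_right (Real.sqrt_le_sqrt ?_) (by linarith)
    exact mul_le_mul_of_nonneg_right (add_le_add (hanti _ _ hn) (hanti _ _ hm)) (by positivity)
  -- the limit is pinned down on `[0, T]` only; elsewhere its value is irrelevant
  have hlim : ∀ t, ∃ l, t ∈ Icc 0 T → Tendsto (fun n => Y n t) atTop (𝓝 l) := by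
    intro t
    by_cases ht : t ∈ Icc 0 T
    · obtain ⟨l, hl⟩ := cauchySeq_tendsto_of_complete
        (cauchySeq_of_le_tendsto_0 r (hdist t ht) hrlim)
      exact ⟨l, fun _ => hl⟩
    · exact ⟨0, fun h => absurd h ht⟩
  choose y hy using hlim
  have hyr : ∀ t ∈ Icc 0 T, ∀ n, ‖Y n t - y t‖ ≤ r n := by
    intro t ht n
    refine le_of_tendsto ((tendsto_const_nhds.sub (hy t ht)).norm) ?_
    filter_upwards [eventually_ge_atTop n] with m hm
    rw [← dist_eq_norm]
    exact hdist t ht n m n le_rfl hm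
  have hYsub : ∀ n s t, Y n s - Y n t = ∫ r in s..t, η n r := by
    intro n s t
    simp only [hY]
    rw [neg_sub_neg, intervalIntegral.integral_interval_sub_left (hη n _ _) (hη n _ _)]
  have hYlip : ∀ n, ∀ s ∈ Icc 0 T, ∀ t ∈ Icc 0 T, ‖Y n s - Y n t‖ ≤ L * |s - t| := by
    intro n s hs t ht
    rw [hYsub, abs_sub_comm]
    refine intervalIntegral.norm_integral_le_of_norm_le_const fun r hr => (hη' n r ?_).2
    exact uIcc_subset_Icc hs ht (uIoc_subset_uIcc hr)
  have hylip : LipschitzOnWith L.toNNReal y (Icc 0 T) := by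
    refine LipschitzOnWith.of_dist_le_mul fun s hs t ht => ?_
    rw [Real.coe_toNNReal L hL.le, dist_eq_norm, Real.dist_eq]
    exact le_of_tendsto ((hy s hs).sub (hy t ht)).norm
      (Eventually.of_forall fun n => hYlip n s hs t ht)
  have h0 : (0 : ℝ) ∈ Icc 0 T := ⟨le_rfl, hT.le⟩
  have hy0 : y 0 = 0 := by
    refine tendsto_nhds_unique (hy 0 h0) ?_
    simp [hY]
  refine ⟨y, L.toNNReal, hy0, hylip, ?_⟩
  set x : ℝ → H := fun t => x₀ + (∫ s in 0..t, h s) + y t with hx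
  have hxc : ContinuousOn x (Icc 0 T) := by
    refine (continuousOn_const.add ?_).add hylip.continuousOn
    simpa [uIcc_of_le hT.le] using hh.absolutelyContinuousOnInterval_integral.continuousOn
  have hux : ∀ n, ∀ t ∈ Icc 0 T, ‖u n t - x t‖ ≤ e n + r n := by
    intro n t ht
    have e1 : u n t - x t = (Y n t - y t)
        - (x₀ + (∫ s in 0..t, h s) - (∫ s in 0..t, η n s) - u n t) := by
      simp only [hY, hx]; abel
    rw [e1]
    exact (norm_sub_le _ _).trans (by linarith [hyr t ht n, hu n t ht])
  intro t₀ ht₀ ξ ε hε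
  obtain ⟨δ₁, hδ₁, hφδ⟩ := Metric.continuous_iff.1 hφ (x t₀) (ε / 2) (half_pos hε)
  set δ' := min (δ₁ / 4) (ε / (4 * L)) with hδ'
  have hδ'0 : 0 < δ' := lt_min (by positivity) (by positivity)
  have hδ'1 : 2 * δ' < δ₁ := by linarith [min_le_left (δ₁ / 4) (ε / (4 * L))]
  have hδ'2 : L * (2 * δ') ≤ ε / 2 := by
    have := (le_div_iff₀ (by positivity)).1 (min_le_right (δ₁ / 4) (ε / (4 * L)))
    linarith
  obtain ⟨δ, hδ, hxδ⟩ := Metric.continuousOn_iff.1 hxc t₀ ht₀ δ' hδ'0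
  refine ⟨δ, hδ, fun s hs t ht hst₀ htt₀ hst => ?_⟩
  refine le_of_tendsto (((hy s hs).sub (hy t ht)).inner tendsto_const_nhds) ?_
  have hρ : ∀ᶠ n in atTop, e n + r n < δ' := by
    have := helim.add hrlim
    rw [add_zero] at this
    exact this.eventually (gt_mem_nhds hδ'0)
  filter_upwards [hρ] with n hn
  have hpt : ∀ q ∈ Icc s t, inner ℝ (η n q) (ξ - x t₀) ≤ φ ξ - φ (x t₀) + ε := by
    intro q hq
    have hqT : q ∈ Icc 0 T := ⟨hs.1.trans hq.1, hq.2.trans ht.2⟩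
    have hq0 : dist q t₀ < δ := by
      rw [Real.dist_eq, abs_lt]
      exact ⟨by linarith [(abs_lt.1 hst₀).1, hq.1], by linarith [(abs_lt.1 htt₀).2, hq.2]⟩
    have h1 : ‖u n q - x t₀‖ ≤ 2 * δ' := by
      have h2 := hxδ q hqT hq0
      rw [dist_eq_norm] at h2
      have h3 := norm_add_le (u n q - x q) (x q - x t₀)
      rw [sub_add_sub_cancel] at h3
      linarith [hux n q hqT]
    have h4 := hφδ (u n q) (by rw [dist_eq_norm]; linarith)
    rw [Real.dist_eq] at h4
    have h5 := (hη' n q hqT).1 ξ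
    have h6 : inner ℝ (η n q) (ξ - x t₀)
        = inner ℝ (η n q) (ξ - u n q) + inner ℝ (η n q) (u n q - x t₀) := by
      rw [← inner_add_right, sub_add_sub_cancel]
    have h7 := real_inner_le_norm (η n q) (u n q - x t₀)
    have h8 := mul_le_mul (hη' n q hqT).2 h1 (norm_nonneg _) hL.le
    linarith [(abs_lt.1 h4).1]
  have hint : inner ℝ (∫ q in s..t, η n q) (ξ - x t₀)
      = ∫ q in s..t, inner ℝ (η n q) (ξ - x t₀) := by
    simp only [intervalIntegral.integral_of_le hst, real_inner_comm (ξ - x t₀)]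
    exact (integral_inner ((intervalIntegrable_iff_integrableOn_Ioc_of_le hst).1 (hη n s t)) _).symm
  have hii : IntervalIntegrable (fun q => inner ℝ (η n q) (ξ - x t₀)) volume s t := by
    rw [intervalIntegrable_iff_integrableOn_Ioc_of_le hst]
    exact ((intervalIntegrable_iff_integrableOn_Ioc_of_le hst).1 (hη n s t)).inner_const _
  have hle := intervalIntegral.integral_mono_on hst hii intervalIntegrable_const hpt
  rw [intervalIntegral.integral_const, smul_eq_mul, mul_comm] at hle
  rw [hYsub, hint]
  exact hle

end Existence

/-! ### Contraction and right derivatives -/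

theorem AbsolutelyContinuousOnInterval.comp_add_const {X : Type*} [PseudoMetricSpace X]
    {f : ℝ → X} {a b τ : ℝ} (hf : AbsolutelyContinuousOnInterval f (a + τ) (b + τ)) :
    AbsolutelyContinuousOnInterval (fun t => f (t + τ)) a b := by
  rw [absolutelyContinuousOnInterval_iff] at hf ⊢
  intro ε hε
  obtain ⟨δ, hδ, hfδ⟩ := hf ε hε
  refine ⟨δ, hδ, fun E hE hEδ => ?_⟩
  refine hfδ (E.1, fun i => ((E.2 i).1 + τ, (E.2 i).2 + τ)) ⟨fun i hi => ?_, ?_⟩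
    (by simpa using hEδ)
  · have h1 := hE.1 i hi
    simp only [mem_uIcc] at h1 ⊢
    constructor
    · rcases h1.1 with h | h
      · exact Or.inl ⟨by linarith, by linarith⟩
      · exact Or.inr ⟨by linarith, by linarith⟩
    · rcases h1.2 with h | h
      · exact Or.inl ⟨by linarith, by linarith⟩
      · exact Or.inr ⟨by linarith, by linarith⟩
  · intro i hi j hj hij
    have h1 := hE.2 hi hj hij
    simp only [Function.onFun, Set.disjoint_left, mem_uIoc] at h1 ⊢
    intro q hq hq'
    refine @h1 (q - τ) ?_ ?_
    · rcases hq with h | h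
      · exact Or.inl ⟨by linarith, by linarith⟩
      · exact Or.inr ⟨by linarith, by linarith⟩
    · rcases hq' with h | h
      · exact Or.inl ⟨by linarith, by linarith⟩
      · exact Or.inr ⟨by linarith, by linarith⟩

section StrongSolution

variable {H : Type*} [NormedAddCommGroup H] [InnerProductSpace ℝ H] {φ : H → ℝ} {a b : ℝ}
  {h : ℝ → H} {x : ℝ → H}

/-- Solutions of `x' + ∂φ(x) ∋ h` on `[a, b]` that are absolutely continuous up to the end
points. -/
structure IsStrongSolution (φ : H → ℝ) (a b : ℝ) (h x : ℝ → H) : Prop where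
  absolutelyContinuous : AbsolutelyContinuousOnInterval x a b
  inclusion : ∀ᵐ t ∂volume.restrict (Ioo a b), h t - deriv x t ∈ subdifferential φ (x t)

namespace IsStrongSolution

theorem mono {c d : ℝ} (hx : IsStrongSolution φ a b h x) (hac : a ≤ c) (hcd : c ≤ d)
    (hdb : d ≤ b) : IsStrongSolution φ c d h x where
  absolutelyContinuous := hx.absolutelyContinuous.mono <| by
    rw [uIcc_of_le hcd, uIcc_of_le (hac.trans (hcd.trans hdb))]
    exact Icc_subset_Icc hac hdb
  inclusion := ae_restrict_Ioo_mono hac hdb hx.inclusion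

theorem const {c ξ : H} (hξ : ξ ∈ subdifferential φ c) (a b : ℝ) :
    IsStrongSolution φ a b (fun _ => ξ) (fun _ => c) where
  absolutelyContinuous := .const c a b
  inclusion := Eventually.of_forall fun t => by simpa using hξ

theorem comp_add_const {τ : ℝ} (hx : IsStrongSolution φ (a + τ) (b + τ) h x) :
    IsStrongSolution φ a b (fun t => h (t + τ)) (fun t => x (t + τ)) where
  absolutelyContinuous := hx.absolutelyContinuous.comp_add_const
  inclusion := by
    have h1 := hx.inclusion
    rw [ae_restrict_iff' measurableSet_Ioo] at h1 ⊢
    filter_upwards [(measurePreserving_add_right volume τ).quasiMeasurePreserving.ae h1]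
      with t ht hab
    rw [deriv_comp_add_const]
    exact ht ⟨by linarith [hab.1], by linarith [hab.2]⟩

/-- **Contraction.** The distance of two solutions grows at most by the integral of the distance
of their right-hand sides. -/
theorem norm_sub_le [FiniteDimensional ℝ H] {h₁ h₂ x₁ x₂ : ℝ → H} (hab : a ≤ b)
    (hx₁ : IsStrongSolution φ a b h₁ x₁) (hx₂ : IsStrongSolution φ a b h₂ x₂)
    (hh : IntervalIntegrable (fun t => ‖h₁ t - h₂ t‖) volume a b) :
    ‖x₁ b - x₂ b‖ ≤ ‖x₁ a - x₂ a‖ + ∫ t in a..b, ‖h₁ t - h₂ t‖ := by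
  refine norm_le_of_inner_deriv_le (w := fun t => x₁ t - x₂ t) hab
    (hx₁.absolutelyContinuous.fun_sub hx₂.absolutelyContinuous) hh (fun t => norm_nonneg _) ?_
  filter_upwards [hx₁.inclusion, hx₂.inclusion,
    hx₁.absolutelyContinuous.ae_differentiableAt_of_finiteDimensional hab,
    hx₂.absolutelyContinuous.ae_differentiableAt_of_finiteDimensional hab] with t h1 h2 d1 d2
  rw [deriv_fun_sub d1 d2]
  have hm := subdifferential_monotone h1 h2
  have e : inner ℝ (x₁ t - x₂ t) (deriv x₁ t - deriv x₂ t)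
      = inner ℝ (h₁ t - h₂ t) (x₁ t - x₂ t)
        - inner ℝ (h₁ t - deriv x₁ t - (h₂ t - deriv x₂ t)) (x₁ t - x₂ t) := by
    rw [← inner_sub_left, real_inner_comm]
    congr 1
    abel
  rw [e]
  linarith [real_inner_le_norm (h₁ t - h₂ t) (x₁ t - x₂ t)]

end IsStrongSolution

end StrongSolution

section RightDerivative

theorem hasDerivWithinAt_Ici_iff_tendsto_slope_zero {F : Type*} [NormedAddCommGroup F]
    [NormedSpace ℝ F] {f : ℝ → F} {t : ℝ} {v : F} :
    HasDerivWithinAt f v (Ici t) t ↔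
      Tendsto (fun τ : ℝ => τ⁻¹ • (f (t + τ) - f t)) (𝓝[>] 0) (𝓝 v) := by
  have hshift : ∀ c d : ℝ, Tendsto (fun s => s + d) (𝓝[>] c) (𝓝[>] (c + d)) := fun c d => by
    refine tendsto_nhdsWithin_iff.2 ⟨?_, ?_⟩
    · exact ((continuous_id.add continuous_const).tendsto c).mono_left nhdsWithin_le_nhds
    · filter_upwards [self_mem_nhdsWithin] with s hs using add_lt_add_left (mem_Ioi.1 hs) d
  rw [← hasDerivWithinAt_Ioi_iff_Ici, hasDerivWithinAt_iff_tendsto_slope' self_notMem_Ioi]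
  constructor
  · intro h
    have h1 := hshift 0 t
    rw [zero_add] at h1
    refine (h.comp h1).congr fun τ => ?_
    simp [slope_def_module, add_comm]
  · intro h
    have h1 := hshift t (-t)
    rw [add_neg_cancel] at h1
    refine (h.comp h1).congr fun s => ?_
    simp [slope_def_module, ← sub_eq_add_neg]

theorem IsRightLebesguePoint.tendsto_average {H : Type*} [NormedAddCommGroup H] [NormedSpace ℝ H]
    [CompleteSpace H] {h : ℝ → H} {T t₀ : ℝ} {l : H} (hh : IntervalIntegrable h volume 0 T)
    (ht₀ : t₀ ∈ Ico 0 T) (hl : IsRightLebesguePoint h t₀ l) :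
    Tendsto (fun τ : ℝ => (1 / τ) • ∫ s in t₀..(t₀ + τ), h s) (𝓝[>] 0) (𝓝 l) := by
  rw [tendsto_iff_norm_sub_tendsto_zero]
  refine squeeze_zero' (Eventually.of_forall fun τ => norm_nonneg _) ?_ hl
  filter_upwards [Ioo_mem_nhdsGT (sub_pos.2 ht₀.2)] with τ hτ
  have hint : IntervalIntegrable h volume t₀ (t₀ + τ) := by
    refine hh.mono_set ?_
    rw [uIcc_of_le (by linarith [hτ.1]), uIcc_of_le (ht₀.1.trans ht₀.2.le)]
    exact Icc_subset_Icc ht₀.1 (by linarith [hτ.2])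
  have e : (1 / τ) • (∫ s in t₀..(t₀ + τ), h s) - l
      = (1 / τ) • ∫ s in t₀..(t₀ + τ), (h s - l) := by
    rw [intervalIntegral.integral_sub hint intervalIntegrable_const,
      intervalIntegral.integral_const, add_sub_cancel_left, smul_sub, smul_smul,
      one_div_mul_cancel hτ.1.ne', one_smul]
  rw [e, norm_smul, Real.norm_of_nonneg (by have := hτ.1; positivity)]
  exact mul_le_mul_of_nonneg_left
    (intervalIntegral.norm_integral_le_integral_norm (by linarith [hτ.1]))
    (by have := hτ.1; positivity)

variable {H : Type*} [NormedAddCommGroup H] [InnerProductSpace ℝ H]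

/-- The nearest point of a closed convex set, with strict minimality in place of uniqueness. -/
theorem exists_nearest_point [CompleteSpace H] {S : Set H} (hne : S.Nonempty) (hcl : IsClosed S)
    (hconv : Convex ℝ S) (l : H) : ∃ ξ ∈ S, ∀ w ∈ S, w ≠ ξ → ‖l - ξ‖ < ‖l - w‖ := by
  obtain ⟨ξ, hξ, hmin⟩ := exists_norm_eq_iInf_of_complete_convex hne hcl.isComplete hconv l
  rw [norm_eq_iInf_iff_real_inner_le_zero hconv hξ] at hmin
  refine ⟨ξ, hξ, fun w hw hne => ?_⟩
  have h1 := norm_sub_sq_real (l - ξ) (w - ξ)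
  rw [sub_sub_sub_cancel_right] at h1
  have h2 : 0 < ‖w - ξ‖ := norm_pos_iff.2 (sub_ne_zero.2 hne)
  have h3 := hmin w hw
  nlinarith [norm_nonneg (l - ξ), norm_nonneg (l - w)]

variable {φ : H → ℝ} {T : ℝ} {x y : ℝ → H}

/-- Every limit point of the right difference quotients of `-y` is a subgradient; `y` need not be
differentiable. -/
theorem WeakInclusion.mem_subdifferential_of_mapClusterPt (hxy : WeakInclusion φ T x y) {t₀ : ℝ}
    (ht₀ : t₀ ∈ Ico 0 T) {v : H}
    (hv : MapClusterPt v (𝓝[>] 0) fun τ => τ⁻¹ • (y t₀ - y (t₀ + τ))) :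
    v ∈ subdifferential φ (x t₀) := by
  intro ξ
  refine le_of_forall_pos_le_add fun ε hε => ?_
  have ht₀' : t₀ ∈ Icc 0 T := Ico_subset_Icc_self ht₀
  obtain ⟨δ, hδ, hxyδ⟩ := hxy t₀ ht₀' ξ ε hε
  have hev : ∀ᶠ τ in 𝓝[>] (0 : ℝ),
      τ⁻¹ • (y t₀ - y (t₀ + τ)) ∈ {w | inner ℝ w (ξ - x t₀) ≤ φ ξ - φ (x t₀) + ε} := by
    filter_upwards [Ioo_mem_nhdsGT (sub_pos.2 ht₀.2), Ioo_mem_nhdsGT hδ] with τ hτ hτ'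
    have h1 := hxyδ t₀ ht₀' (t₀ + τ) ⟨by linarith [ht₀.1, hτ.1], by linarith [hτ.2]⟩
      (by simpa using hδ) (by simpa [abs_of_pos hτ'.1] using hτ'.2) (by linarith [hτ.1])
    rw [add_sub_cancel_left] at h1
    change inner ℝ (τ⁻¹ • (y t₀ - y (t₀ + τ))) (ξ - x t₀) ≤ _
    rw [inner_smul_left, conj_trivial, inv_mul_le_iff₀ hτ.1]
    linarith
  have hclosed : IsClosed {w | inner ℝ w (ξ - x t₀) ≤ φ ξ - φ (x t₀) + ε} :=
    isClosed_le (by fun_prop) continuous_const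
  exact hclosed.mem_of_mapClusterPt hv hev

theorem WeakInclusion.neg_deriv_mem_subdifferential (hxy : WeakInclusion φ T x y) {t₀ : ℝ}
    (ht₀ : t₀ ∈ Ico 0 T) {v : H} (hv : HasDerivAt y v t₀) :
    -v ∈ subdifferential φ (x t₀) := by
  refine hxy.mem_subdifferential_of_mapClusterPt ht₀ (Tendsto.mapClusterPt ?_)
  refine hv.tendsto_slope_zero_right.neg.congr fun τ => ?_
  rw [← smul_neg, neg_sub]

variable [FiniteDimensional ℝ H] {h : ℝ → H} {x₀ : H} {L : NNReal}

theorem WeakInclusion.ae_hasDerivAt (hT : 0 < T)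
    (hxy : WeakInclusion φ T x y) (hx : x = fun t => x₀ + (∫ s in 0..t, h s) + y t)
    (hy : LipschitzOnWith L y (Icc 0 T)) (hh : IntervalIntegrable h volume 0 T) :
    ∀ᵐ t ∂volume.restrict (Ioo 0 T), ∃ v, ‖v‖ ≤ L ∧ HasDerivAt x (h t - v) t ∧
      v ∈ subdifferential φ (x t) := by
  have hyac : AbsolutelyContinuousOnInterval y 0 T :=
    LipschitzOnWith.absolutelyContinuousOnInterval (by rwa [uIcc_of_le hT.le])
  filter_upwards [hh.ae_hasDerivAt_integral_restrict_Ioo hT.le,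
    hyac.ae_differentiableAt_of_finiteDimensional hT.le, ae_restrict_mem measurableSet_Ioo]
    with t h1 h2 ht
  refine ⟨-deriv y t, ?_, ?_, hxy.neg_deriv_mem_subdifferential (Ioo_subset_Ico_self ht)
    h2.hasDerivAt⟩
  · rw [norm_neg]
    exact norm_deriv_le_of_lipschitzOn (Icc_mem_nhds ht.1 ht.2) hy
  · rw [hx, sub_neg_eq_add]
    exact (h1.const_add x₀).add h2.hasDerivAt

theorem WeakInclusion.isStrongSolution (hT : 0 < T)
    (hxy : WeakInclusion φ T x y) (hx : x = fun t => x₀ + (∫ s in 0..t, h s) + y t)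
    (hy : LipschitzOnWith L y (Icc 0 T)) (hh : IntervalIntegrable h volume 0 T) :
    IsStrongSolution φ 0 T h x where
  absolutelyContinuous := by
    rw [hx]
    exact ((AbsolutelyContinuousOnInterval.const x₀ 0 T).fun_add
      hh.absolutelyContinuousOnInterval_integral).fun_add
      (LipschitzOnWith.absolutelyContinuousOnInterval (by rwa [uIcc_of_le hT.le]))
  inclusion := by
    filter_upwards [hxy.ae_hasDerivAt hT hx hy hh] with t ⟨v, _, hv, hv'⟩
    rwa [hv.deriv, sub_sub_cancel]

/-- At a right-Lebesgue point, the residual difference quotients accumulate only at subgradients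
whose distance to `l` is at most that of the nearest one, hence converge to the nearest one. -/
theorem WeakInclusion.exists_hasDerivWithinAt (hT : 0 < T)
    (hne : ∀ x, (subdifferential φ x).Nonempty)
    (hxy : WeakInclusion φ T x y) (hx : x = fun t => x₀ + (∫ s in 0..t, h s) + y t)
    (hy : LipschitzOnWith L y (Icc 0 T)) (hh : IntervalIntegrable h volume 0 T) {t₀ : ℝ}
    (ht₀ : t₀ ∈ Ico 0 T) {l : H} (hl : IsRightLebesguePoint h t₀ l) :
    ∃ v, IsMinimalElement ((fun y => l - y) '' subdifferential φ (x t₀)) v ∧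
      HasDerivWithinAt x v (Ici t₀) t₀ := by
  obtain ⟨ξ, hξ, hmin⟩ := exists_nearest_point (hne (x t₀)) (isClosed_subdifferential _)
    (convex_subdifferential _) l
  have havg := hl.tendsto_average hh ht₀
  have hsol := hxy.isStrongSolution hT hx hy hh
  have hsub : ∀ τ ∈ Ioo 0 (T - t₀), uIcc t₀ (t₀ + τ) ⊆ uIcc 0 T := fun τ hτ => by
    rw [uIcc_of_le (by linarith [hτ.1]), uIcc_of_le hT.le]
    exact Icc_subset_Icc ht₀.1 (by linarith [hτ.2])
  set q : ℝ → H := fun τ => τ⁻¹ • (y t₀ - y (t₀ + τ)) with hq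
  have hquot : ∀ τ ∈ Ioo 0 (T - t₀),
      τ⁻¹ • (x (t₀ + τ) - x t₀) = (1 / τ) • (∫ s in t₀..(t₀ + τ), h s) - q τ := by
    intro τ hτ
    have h0 : IntervalIntegrable h volume 0 t₀ := by
      refine hh.mono_set (uIcc_subset_uIcc left_mem_uIcc ?_)
      exact hsub τ hτ left_mem_uIcc
    have h1 := intervalIntegral.integral_add_adjacent_intervals h0 (hh.mono_set (hsub τ hτ))
    rw [hq, one_div, ← smul_sub, hx]
    simp only
    rw [← h1]
    congr 1
    abel
  -- comparison of `x` with the constant solution `x t₀` for the right-hand side `ξ`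
  have hbound : ∀ τ ∈ Ioo 0 (T - t₀), ‖τ⁻¹ • (x (t₀ + τ) - x t₀)‖
      ≤ ‖l - ξ‖ + (1 / τ) * ∫ s in t₀..(t₀ + τ), ‖h s - l‖ := by
    intro τ hτ
    have hle : t₀ ≤ t₀ + τ := by linarith [hτ.1]
    have hhτ := hh.mono_set (hsub τ hτ)
    have h1 := (hsol.mono ht₀.1 hle (by linarith [hτ.2])).norm_sub_le hle
      (IsStrongSolution.const hξ _ _) (hhτ.sub intervalIntegrable_const).norm
    rw [sub_self, norm_zero, zero_add] at h1
    have h2 : ∫ s in t₀..(t₀ + τ), ‖h s - ξ‖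
        ≤ (∫ s in t₀..(t₀ + τ), ‖h s - l‖) + τ * ‖l - ξ‖ := by
      have e : τ * ‖l - ξ‖ = ∫ s in t₀..(t₀ + τ), ‖l - ξ‖ := by simp
      rw [e, ← intervalIntegral.integral_add (hhτ.sub intervalIntegrable_const).norm
        intervalIntegrable_const]
      refine intervalIntegral.integral_mono_on hle (hhτ.sub intervalIntegrable_const).norm
        ((hhτ.sub intervalIntegrable_const).norm.add intervalIntegrable_const) fun s _ => ?_
      have := norm_add_le (h s - l) (l - ξ)
      rwa [sub_add_sub_cancel] at this
    rw [norm_smul, norm_inv, Real.norm_of_nonneg hτ.1.le, inv_mul_le_iff₀ hτ.1, mul_add,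
      ← mul_assoc, mul_one_div_cancel hτ.1.ne', one_mul]
    linarith
  have hqL : ∀ᶠ τ in 𝓝[>] (0 : ℝ), q τ ∈ Metric.closedBall (0 : H) L := by
    filter_upwards [Ioo_mem_nhdsGT (sub_pos.2 ht₀.2)] with τ hτ
    rw [mem_closedBall_zero_iff, hq, norm_smul, norm_inv, Real.norm_of_nonneg hτ.1.le,
      inv_mul_le_iff₀ hτ.1, ← dist_eq_norm]
    refine (hy.dist_le_mul _ (Ico_subset_Icc_self ht₀) (t₀ + τ)
      ⟨by linarith [ht₀.1, hτ.1], by linarith [hτ.2]⟩).trans ?_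
    rw [Real.dist_eq, sub_add_cancel_left, abs_neg, abs_of_pos hτ.1, mul_comm]
  have hqξ : Tendsto q (𝓝[>] 0) (𝓝 ξ) := by
    refine (isCompact_closedBall (0 : H) (L : ℝ)).tendsto_nhds_of_unique_mapClusterPt hqL
      fun v _ hv => ?_
    have hvS := hxy.mem_subdifferential_of_mapClusterPt ht₀ hv
    by_contra hvξ
    have hlt := hmin v hvS hvξ
    obtain ⟨m, hm1, hm2⟩ := exists_between hlt
    have hev : ∀ᶠ τ in 𝓝[>] (0 : ℝ), q τ ∈ {w | ‖l - w‖ ≤ m} := by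
      have h1 : Tendsto (fun τ : ℝ => ‖l - (1 / τ) • ∫ s in t₀..(t₀ + τ), h s‖
          + (‖l - ξ‖ + (1 / τ) * ∫ s in t₀..(t₀ + τ), ‖h s - l‖)) (𝓝[>] 0)
          (𝓝 (‖l - l‖ + (‖l - ξ‖ + 0))) :=
        (tendsto_const_nhds.sub havg).norm.add (tendsto_const_nhds.add hl)
      rw [sub_self, norm_zero, zero_add, add_zero] at h1
      filter_upwards [h1.eventually (gt_mem_nhds hm1), Ioo_mem_nhdsGT (sub_pos.2 ht₀.2)]
        with τ hτm hτ
      have h2 := hbound τ hτ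
      have h3 := norm_add_le (l - (1 / τ) • ∫ s in t₀..(t₀ + τ), h s)
        (τ⁻¹ • (x (t₀ + τ) - x t₀))
      rw [hquot τ hτ, sub_add_sub_cancel, ← hquot τ hτ] at h3
      exact (h3.trans (by linarith)).trans hτm.le
    have hclosed : IsClosed {w : H | ‖l - w‖ ≤ m} := isClosed_le (by fun_prop) continuous_const
    have hvm : v ∈ {w : H | ‖l - w‖ ≤ m} := hclosed.mem_of_mapClusterPt hv hev
    exact absurd hm2 (not_lt.2 hvm)
  refine ⟨l - ξ, ⟨mem_image_of_mem _ hξ, ?_⟩, ?_⟩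
  · rintro _ ⟨w, hw, rfl⟩ hwξ
    exact hmin w hw fun e => hwξ (by rw [e])
  · rw [hasDerivWithinAt_Ici_iff_tendsto_slope_zero]
    have h1 : Tendsto (fun τ : ℝ => τ⁻¹ • (x (t₀ + τ) - x t₀)) (𝓝[>] 0) (𝓝 (l - ξ)) := by
      refine (havg.sub hqξ).congr' ?_
      filter_upwards [Ioo_mem_nhdsGT (sub_pos.2 ht₀.2)] with τ hτ using (hquot τ hτ).symm
    exact h1

end RightDerivative

/-! ### Energy estimate and growth of the speed -/

/-- The Cauchy–Schwarz inequality for integrals of products of norms. -/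
theorem integral_norm_mul_norm_le_sqrt {α E : Type*} [MeasurableSpace α] {μ : Measure α}
    [NormedAddCommGroup E] {f g : α → E} (hf : MemLp f 2 μ) (hg : MemLp g 2 μ) :
    ∫ a, ‖f a‖ * ‖g a‖ ∂μ ≤ √(∫ a, ‖f a‖ ^ 2 ∂μ) * √(∫ a, ‖g a‖ ^ 2 ∂μ) := by
  have h2 : ENNReal.ofReal 2 = 2 := by norm_num
  have := integral_mul_norm_le_Lp_mul_Lq (p := 2) (q := 2) (μ := μ) (f := f) (g := g)
    ⟨by norm_num, by norm_num, by norm_num⟩ (by rwa [h2]) (by rwa [h2])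
  simpa [Real.sqrt_eq_rpow] using this

section Estimates

variable {H : Type*} [NormedAddCommGroup H] [InnerProductSpace ℝ H] [FiniteDimensional ℝ H]

theorem AbsolutelyContinuousOnInterval.norm_sub_le_integral_norm_deriv {f : ℝ → H} {a b : ℝ}
    (hab : a ≤ b) (hf : AbsolutelyContinuousOnInterval f a b)
    (hd : IntervalIntegrable (fun t => ‖deriv f t‖) volume a b) :
    ‖f b - f a‖ ≤ ∫ t in a..b, ‖deriv f t‖ := by
  have h1 := norm_le_of_inner_deriv_le (w := fun t => f t - f a) hab
    (hf.fun_sub (.const (f a) a b)) hd (fun t => norm_nonneg _) <| Eventually.of_forall fun t => by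
      rw [deriv_sub_const, mul_comm]
      exact real_inner_le_norm _ _
  simpa using h1

namespace IsStrongSolution

variable {φ : H → ℝ} {T : ℝ} {h x : ℝ → H} {z : H}

theorem absolutelyContinuousOnInterval_comp {a b : ℝ} (hx : IsStrongSolution φ a b h x)
    (hφ : Continuous φ) (hne : ∀ x, (subdifferential φ x).Nonempty) :
    AbsolutelyContinuousOnInterval (fun t => φ (x t)) a b := by
  obtain ⟨R, hR⟩ := hx.absolutelyContinuous.exists_bound
  obtain ⟨K, hK⟩ := exists_lipschitzOnWith_of_subdifferential_nonempty hφ hne R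
  exact hx.absolutelyContinuous.lipschitzOnWith_comp hK fun t ht =>
    mem_closedBall_zero_iff.2 (hR t ht)

/-- The energy estimate: `∫ ‖x'‖² + φ(x(t)) - φ(x(0)) = ∫ ⟪h, x'⟫`, followed by Cauchy–Schwarz. -/
theorem sqrt_integral_norm_deriv_sq_le (hx : IsStrongSolution φ 0 T h x) (hφ : Continuous φ)
    (hφ0 : ∀ x, 0 ≤ φ x) (hne : ∀ x, (subdifferential φ x).Nonempty)
    (hh : MemLp h 2 (volume.restrict (Ioo 0 T)))
    (hx' : MemLp (deriv x) 2 (volume.restrict (Ioo 0 T))) {t : ℝ} (ht : t ∈ Icc 0 T) :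
    √(∫ s in 0..t, ‖deriv x s‖ ^ 2) ≤ √(∫ s in 0..t, ‖h s‖ ^ 2) + √(φ (x 0)) := by
  have hμ : volume.restrict (Ioc 0 t) ≤ volume.restrict (Ioo 0 T) := by
    rw [Measure.restrict_congr_set (Ioo_ae_eq_Ioc (a := 0) (b := T))]
    exact Measure.restrict_mono (Ioc_subset_Ioc_right ht.2) le_rfl
  have hh2 := hh.mono_measure hμ
  have hx2 := hx'.mono_measure hμ
  have hxt := hx.mono le_rfl ht.1 ht.2
  have hcs := integral_norm_mul_norm_le_sqrt hh2 hx2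
  simp only [← intervalIntegral.integral_of_le ht.1] at hcs
  have hi1 : IntervalIntegrable (fun s => ‖h s‖ * ‖deriv x s‖) volume 0 t := by
    rw [intervalIntegrable_iff_integrableOn_Ioc_of_le ht.1]
    exact MemLp.integrable_mul hh2.norm hx2.norm
  have hi2 : IntervalIntegrable (fun s => ‖deriv x s‖ ^ 2) volume 0 t := by
    rw [intervalIntegrable_iff_integrableOn_Ioc_of_le ht.1]
    exact hx2.norm.integrable_sq
  have hac := hxt.absolutelyContinuousOnInterval_comp hφ hne
  have hle := hac.sub_le_integral ht.1 (hi1.sub hi2) <| by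
    filter_upwards [hxt.inclusion,
      hxt.absolutelyContinuous.ae_differentiableAt_of_finiteDimensional ht.1,
      hac.ae_differentiableAt_of_finiteDimensional ht.1] with s h1 h2 h3
    rw [deriv_comp_eq_inner_of_mem_subdifferential h1 h2 h3, inner_sub_left,
      real_inner_self_eq_norm_sq]
    linarith [real_inner_le_norm (h s) (deriv x s)]
  rw [intervalIntegral.integral_sub hi1 hi2] at hle
  set X := ∫ s in 0..t, ‖deriv x s‖ ^ 2
  set Y := ∫ s in 0..t, ‖h s‖ ^ 2
  have hX : 0 ≤ X := intervalIntegral.integral_nonneg ht.1 fun s _ => by positivity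
  have h1 := Real.sq_sqrt hX
  have h2 := Real.sq_sqrt (hφ0 (x 0))
  have h3 := hφ0 (x t)
  by_contra! hcon
  nlinarith [Real.sqrt_nonneg X, Real.sqrt_nonneg Y, Real.sqrt_nonneg (φ (x 0)),
    mul_nonneg (Real.sqrt_nonneg Y) (Real.sqrt_nonneg (φ (x 0)))]

/-- The speed of a solution grows at most by the variation of the right-hand side: compare the
solution with its time shifts. -/
theorem norm_rightDeriv_le (hx : IsStrongSolution φ 0 T h x)
    (hh : AbsolutelyContinuousOnInterval h 0 T)
    (hh' : IntervalIntegrable (fun t => ‖deriv h t‖) volume 0 T) {s t : ℝ} (hs : 0 ≤ s)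
    (hst : s ≤ t) (htT : t < T) {u v : H} (hu : HasDerivWithinAt x u (Ici s) s)
    (hv : HasDerivWithinAt x v (Ici t) t) : ‖v‖ ≤ ‖u‖ + ∫ r in s..t, ‖deriv h r‖ := by
  have hT : 0 ≤ T := by linarith
  set g : ℝ → ℝ := fun t => ∫ r in 0..t, ‖deriv h r‖ with hg
  have hgc : ContinuousOn g (Icc 0 T) := by
    simpa [uIcc_of_le hT] using hh'.absolutelyContinuousOnInterval_integral.continuousOn
  have hii : ∀ a b, 0 ≤ a → a ≤ b → b ≤ T →
      IntervalIntegrable (fun t => ‖deriv h t‖) volume a b := fun a b ha hab hb => by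
    refine hh'.mono_set ?_
    rw [uIcc_of_le hab, uIcc_of_le hT]
    exact Icc_subset_Icc ha hb
  have hgsub : ∀ a b, 0 ≤ a → a ≤ b → b ≤ T → g b - g a = ∫ r in a..b, ‖deriv h r‖ :=
    fun a b ha hab hb =>
      intervalIntegral.integral_interval_sub_left (hii 0 b le_rfl (ha.trans hab) hb)
        (hii 0 a le_rfl ha (hab.trans hb))
  have hgmono : ∀ a b, 0 ≤ a → a ≤ b → b ≤ T → g a ≤ g b := fun a b ha hab hb => by
    have : 0 ≤ ∫ r in a..b, ‖deriv h r‖ :=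
      intervalIntegral.integral_nonneg hab fun r _ => norm_nonneg _
    linarith [hgsub a b ha hab hb]
  have hgi : ∀ a b, 0 ≤ a → a ≤ b → b ≤ T → IntervalIntegrable g volume a b :=
    fun a b ha hab hb => by
      refine (hgc.mono ?_).intervalIntegrable
      rw [uIcc_of_le hab]
      exact Icc_subset_Icc ha hb
  -- contraction for the shifted solution; `‖h (r + τ) - h r‖ ≤ g (r + τ) - g r`, whose integral
  -- telescopes
  have hkey : ∀ᶠ τ in 𝓝[>] (0 : ℝ), ‖τ⁻¹ • (x (t + τ) - x t)‖
      ≤ ‖τ⁻¹ • (x (s + τ) - x s)‖ + (g (t + τ) - g s) := by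
    filter_upwards [Ioo_mem_nhdsGT (sub_pos.2 htT)] with τ hτ
    have hτ0 := hτ.1
    have hτT : t + τ ≤ T := by linarith [hτ.2]
    have hc : ∀ f : ℝ → H, AbsolutelyContinuousOnInterval f 0 T →
        ContinuousOn f (Icc s t) ∧ ContinuousOn (fun r => f (r + τ)) (Icc s t) := by
      intro f hf
      have hfc : ContinuousOn f (Icc 0 T) := by simpa [uIcc_of_le hT] using hf.continuousOn
      exact ⟨hfc.mono (Icc_subset_Icc hs htT.le), hfc.comp (by fun_prop)
        fun r hr => ⟨by linarith [hr.1], by linarith [hr.2]⟩⟩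
    have hdi : IntervalIntegrable (fun r => ‖h (r + τ) - h r‖) volume s t := by
      refine ContinuousOn.intervalIntegrable ?_
      rw [uIcc_of_le hst]
      exact ((hc h hh).2.sub (hc h hh).1).norm
    have h1 := norm_sub_le hst
      (hx.mono (by linarith : 0 ≤ s + τ) (by linarith : s + τ ≤ t + τ) hτT).comp_add_const
      (hx.mono hs hst htT.le) hdi
    have hgτ : IntervalIntegrable (fun r => g (r + τ)) volume s t := by
      simpa using (hgi (s + τ) (t + τ) (by linarith) (by linarith) hτT).comp_add_right τ
    have h2 : ∫ r in s..t, ‖h (r + τ) - h r‖ ≤ ∫ r in s..t, (g (r + τ) - g r) := by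
      refine intervalIntegral.integral_mono_on hst hdi (hgτ.sub (hgi s t hs hst htT.le))
        fun r hr => ?_
      have hr0 : 0 ≤ r := hs.trans hr.1
      have hrτ : r ≤ r + τ := by linarith
      have hrT : r + τ ≤ T := by linarith [hr.2]
      rw [hgsub r (r + τ) hr0 hrτ hrT]
      refine AbsolutelyContinuousOnInterval.norm_sub_le_integral_norm_deriv hrτ (hh.mono ?_)
        (hii _ _ hr0 hrτ hrT)
      rw [uIcc_of_le hrτ, uIcc_of_le hT]
      exact Icc_subset_Icc hr0 hrT
    have h3 : ∫ r in s..t, (g (r + τ) - g r) ≤ τ * (g (t + τ) - g s) := by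
      rw [intervalIntegral.integral_sub hgτ (hgi s t hs hst htT.le),
        intervalIntegral.integral_comp_add_right g τ]
      have e1 := intervalIntegral.integral_add_adjacent_intervals (hgi s t hs hst htT.le)
        (hgi t (t + τ) (hs.trans hst) (by linarith) hτT)
      have e2 := intervalIntegral.integral_add_adjacent_intervals
        (hgi s (s + τ) hs (by linarith) (by linarith))
        (hgi (s + τ) (t + τ) (by linarith) (by linarith) hτT)
      have e3 : ∫ r in t..(t + τ), g r ≤ τ * g (t + τ) := by
        have := intervalIntegral.integral_mono_on (by linarith : t ≤ t + τ)
          (hgi t (t + τ) (hs.trans hst) (by linarith) hτT)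
          (intervalIntegrable_const (c := g (t + τ)))
          fun r hr => hgmono r (t + τ) (hs.trans (hst.trans hr.1)) hr.2 hτT
        simpa using this
      have e4 : τ * g s ≤ ∫ r in s..(s + τ), g r := by
        have := intervalIntegral.integral_mono_on (by linarith : s ≤ s + τ)
          (intervalIntegrable_const (c := g s))
          (hgi s (s + τ) hs (by linarith) (by linarith))
          fun r hr => hgmono s r hs hr.1 (by linarith [hr.2])
        simpa using this
      linarith
    rw [norm_smul, norm_smul, norm_inv, Real.norm_of_nonneg hτ0.le]
    have h4 : τ⁻¹ * (τ * (g (t + τ) - g s)) = g (t + τ) - g s := by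
      rw [← mul_assoc, inv_mul_cancel₀ hτ0.ne', one_mul]
    rw [← h4, ← mul_add]
    exact mul_le_mul_of_nonneg_left (by linarith) (by positivity)
  rw [hasDerivWithinAt_Ici_iff_tendsto_slope_zero] at hu hv
  have hgt : Tendsto (fun τ => g (t + τ)) (𝓝[>] 0) (𝓝 (g t)) := by
    have h1 : Tendsto (fun τ => t + τ) (𝓝[>] 0) (𝓝[Icc 0 T] t) := by
      refine tendsto_nhdsWithin_iff.2 ⟨?_, ?_⟩
      · have : Tendsto (fun τ => t + τ) (𝓝 0) (𝓝 (t + 0)) :=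
          (continuous_const.add continuous_id).tendsto 0
        rw [add_zero] at this
        exact this.mono_left nhdsWithin_le_nhds
      · filter_upwards [Ioo_mem_nhdsGT (sub_pos.2 htT)] with τ hτ
        exact ⟨by linarith [hτ.1], by linarith [hτ.2]⟩
    exact (hgc t ⟨hs.trans hst, htT.le⟩).tendsto.comp h1
  have := le_of_tendsto_of_tendsto hv.norm (hu.norm.add (hgt.sub_const (g s))) hkey
  rwa [hgsub s t hs hst htT.le] at this

end IsStrongSolution

end Estimates

/-! ### The smoothing estimate -/

section Smoothing

variable {H : Type*} [NormedAddCommGroup H] [InnerProductSpace ℝ H] [FiniteDimensional ℝ H]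
  {φ : H → ℝ} {T : ℝ} {h x : ℝ → H} {z : H}

namespace IsStrongSolution

/-- The energy estimate with weight `s`: integrate the derivative of
`½ ‖x - z‖² + s φ(x) - s ⟪h, x - z⟫`, in which the terms `⟪h, x'⟫` cancel. -/
theorem integral_mul_norm_deriv_sq_le (hx : IsStrongSolution φ 0 T h x) (hφ : Continuous φ)
    (hφ0 : ∀ x, 0 ≤ φ x) (hz : φ z = 0) (hne : ∀ x, (subdifferential φ x).Nonempty)
    (hT : 0 ≤ T) (hh : AbsolutelyContinuousOnInterval h 0 T)
    (hh' : IntervalIntegrable (fun s => ‖deriv h s‖) volume 0 T)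
    (hx' : IntervalIntegrable (fun s => ‖deriv x s‖ ^ 2) volume 0 T) :
    ∫ s in 0..T, s * ‖deriv x s‖ ^ 2 ≤ ‖x 0 - z‖ ^ 2 / 2 + (T * ‖h T‖) ^ 2 / 2
      + (∫ s in 0..T, s * ‖deriv h s‖) * (‖x 0 - z‖ + ∫ s in 0..T, ‖h s‖) := by
  set B := ‖x 0 - z‖ + ∫ s in 0..T, ‖h s‖ with hB
  have hhi : IntervalIntegrable (fun s => ‖h s‖) volume 0 T :=
    hh.continuousOn.norm.intervalIntegrable
  have hxB : ∀ s ∈ Icc 0 T, ‖x s - z‖ ≤ B := by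
    intro s hs
    have h0 : (0 : H) ∈ subdifferential φ z := fun ξ => by simpa [hz] using hφ0 ξ
    have hhs := hhi.mono_set (uIcc_subset_uIcc left_mem_uIcc (by rwa [uIcc_of_le hT]) :
      uIcc 0 s ⊆ uIcc 0 T)
    have h1 := (hx.mono le_rfl hs.1 hs.2).norm_sub_le hs.1 (const h0 _ _) (by simpa using hhs)
    have h2 : ∫ r in 0..s, ‖h r‖ ≤ ∫ r in 0..T, ‖h r‖ :=
      intervalIntegral.integral_mono_interval le_rfl hs.1 hs.2
        (Eventually.of_forall fun s => norm_nonneg _) hhi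
    simp only [sub_zero] at h1
    linarith
  set F : ℝ → ℝ := fun s => 1 / 2 * ‖x s - z‖ ^ 2 + (s * φ (x s) - s * inner ℝ (h s) (x s - z))
    with hF
  have hφac := hx.absolutelyContinuousOnInterval_comp hφ hne
  have hxz : AbsolutelyContinuousOnInterval (fun s => x s - z) 0 T :=
    hx.absolutelyContinuous.fun_sub (.const z 0 T)
  have hFac : AbsolutelyContinuousOnInterval F 0 T := by
    have h1 := hxz.real_inner hxz
    simp only [real_inner_self_eq_norm_sq] at h1
    exact (h1.const_mul (1 / 2)).fun_add
      (((AbsolutelyContinuousOnInterval.id 0 T).fun_mul hφac).fun_sub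
        ((AbsolutelyContinuousOnInterval.id 0 T).fun_mul (hh.real_inner hxz)))
  have hi1 : IntervalIntegrable (fun s => s * ‖deriv h s‖) volume 0 T :=
    hh'.continuousOn_mul continuousOn_id
  have hi2 : IntervalIntegrable (fun s => s * ‖deriv x s‖ ^ 2) volume 0 T :=
    hx'.continuousOn_mul continuousOn_id
  have hle := hFac.sub_le_integral hT ((hi1.mul_const B).sub hi2) <| by
    filter_upwards [hx.inclusion, hφac.ae_differentiableAt_of_finiteDimensional hT,
      hx.absolutelyContinuous.ae_differentiableAt_of_finiteDimensional hT,
      hh.ae_differentiableAt_of_finiteDimensional hT, ae_restrict_mem measurableSet_Ioo]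
      with s h1 d1 d2 d3 hs
    have e1 := deriv_comp_eq_inner_of_mem_subdifferential h1 d2 d1
    have d2' := d2.hasDerivAt.sub_const z
    have hd : HasDerivAt F (1 / 2 * (2 * inner ℝ (x s - z) (deriv x s))
        + ((1 * φ (x s) + s * inner ℝ (h s - deriv x s) (deriv x s))
          - (1 * inner ℝ (h s) (x s - z)
            + s * (inner ℝ (h s) (deriv x s) + inner ℝ (deriv h s) (x s - z))))) s := by
      rw [← e1]
      exact (d2'.norm_sq.const_mul (1 / 2)).add
        (((hasDerivAt_id s).mul d1.hasDerivAt).sub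
          ((hasDerivAt_id s).mul (d3.hasDerivAt.inner ℝ d2')))
    rw [hd.deriv]
    have h2 := h1 z
    rw [hz, ← neg_sub (x s) z, inner_neg_right, inner_sub_left,
      real_inner_comm (x s - z) (deriv x s)] at h2
    have h3 := (abs_le.1 (abs_real_inner_le_norm (deriv h s) (x s - z))).1
    have h4 := mul_le_mul_of_nonneg_left (hxB s ⟨hs.1.le, hs.2.le⟩) (norm_nonneg (deriv h s))
    have h5 : s * (-(‖deriv h s‖ * B)) ≤ s * inner ℝ (deriv h s) (x s - z) :=
      mul_le_mul_of_nonneg_left (by linarith) hs.1.le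
    rw [inner_sub_left (h s), real_inner_self_eq_norm_sq]
    linarith
  rw [intervalIntegral.integral_sub (hi1.mul_const B) hi2, intervalIntegral.integral_mul_const]
    at hle
  have hF0 : F 0 = ‖x 0 - z‖ ^ 2 / 2 := by simp only [hF]; ring
  have hFT : -((T * ‖h T‖) ^ 2 / 2) ≤ F T := by
    have h1 := mul_le_mul_of_nonneg_left (real_inner_le_norm (h T) (x T - z)) hT
    have h2 := mul_nonneg hT (hφ0 (x T))
    simp only [hF]
    nlinarith [sq_nonneg (T * ‖h T‖ - ‖x T - z‖)]
  linarith

/-- **Smoothing estimate.** The monotonicity of the speed turns the weighted energy estimate into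
a pointwise bound. -/
theorem norm_rightDeriv_le_smoothing (hx : IsStrongSolution φ 0 T h x) (hφ : Continuous φ)
    (hφ0 : ∀ x, 0 ≤ φ x) (hz : φ z = 0) (hne : ∀ x, (subdifferential φ x).Nonempty)
    (hh : AbsolutelyContinuousOnInterval h 0 T)
    (hh' : IntervalIntegrable (fun s => ‖deriv h s‖) volume 0 T)
    (hx' : MemLp (deriv x) 2 (volume.restrict (Ioo 0 T))) {t : ℝ} (ht : t ∈ Ioo 0 T) {v : H}
    (hv : HasDerivWithinAt x v (Ici t) t) :
    ‖v‖ ≤ ‖h t‖ + (1 / t) * ‖x 0 - z‖ + (1 / t ^ 2) * (∫ s in 0..t, s ^ 2 * ‖deriv h s‖)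
      + (√2 / t) * √(∫ s in 0..t, s * ‖deriv h s‖) * √(‖x 0 - z‖ + ∫ s in 0..t, ‖h s‖) := by
  have ht0 : 0 < t := ht.1
  have hT : 0 ≤ T := ht.1.le.trans ht.2.le
  have hsub : uIcc 0 t ⊆ uIcc 0 T := by
    rw [uIcc_of_le ht0.le, uIcc_of_le hT]
    exact Icc_subset_Icc_right ht.2.le
  have hμ : volume.restrict (Ioc 0 t) ≤ volume.restrict (Ioo 0 T) :=
    Measure.restrict_mono (Ioc_subset_Ioo_right ht.2) le_rfl
  have hx2 := hx'.mono_measure hμ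
  have hi2 : IntervalIntegrable (fun s => ‖deriv x s‖ ^ 2) volume 0 t := by
    rw [intervalIntegrable_iff_integrableOn_Ioc_of_le ht0.le]
    exact hx2.norm.integrable_sq
  have hi1 : IntervalIntegrable (fun s => ‖deriv x s‖) volume 0 t := by
    rw [intervalIntegrable_iff_integrableOn_Ioc_of_le ht0.le]
    exact (hx2.norm.integrable one_le_two)
  have hh't := hh'.mono_set hsub
  have hht := hh.mono hsub
  have hxt := hx.mono le_rfl ht0.le ht.2.le
  have henergy := hxt.integral_mul_norm_deriv_sq_le hφ hφ0 hz hne ht0.le hht hh't hi2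
  set g : ℝ → ℝ := fun s => ∫ r in 0..s, ‖deriv h r‖ with hg
  have hgac : AbsolutelyContinuousOnInterval g 0 t := hh't.absolutelyContinuousOnInterval_integral
  have hidac := AbsolutelyContinuousOnInterval.id 0 t
  -- `M' ≤ 2 s ‖x'‖ + s² ‖h'‖`, because `‖v‖ - (g t - g s) ≤ ‖x' s‖`; integrating `M'` instead of that
  -- inequality avoids an integration by parts
  set M : ℝ → ℝ := fun s => (s * s) * (‖v‖ - g t + g s) with hM
  have hMac : AbsolutelyContinuousOnInterval M 0 t :=
    (hidac.fun_mul hidac).fun_mul ((AbsolutelyContinuousOnInterval.const _ 0 t).fun_add hgac)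
  have hj1 : IntervalIntegrable (fun s => s * ‖deriv x s‖) volume 0 t :=
    hi1.continuousOn_mul continuousOn_id
  have hj2 : IntervalIntegrable (fun s => s ^ 2 * ‖deriv h s‖) volume 0 t :=
    hh't.continuousOn_mul (continuousOn_id.pow 2)
  have hle := hMac.sub_le_integral ht0.le ((hj1.const_mul 2).add hj2) <| by
    filter_upwards [hxt.absolutelyContinuous.ae_differentiableAt_of_finiteDimensional ht0.le,
      hh't.ae_hasDerivAt_integral_restrict_Ioo ht0.le, ae_restrict_mem measurableSet_Ioo]
      with s h1 h2 hs
    have hd : HasDerivAt M ((1 * s + s * 1) * (‖v‖ - g t + g s) + (s * s) * ‖deriv h s‖) s :=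
      ((hasDerivAt_id s).mul (hasDerivAt_id s)).mul (h2.const_add (‖v‖ - g t))
    rw [hd.deriv]
    have h3 := hx.norm_rightDeriv_le hh hh' hs.1.le hs.2.le ht.2 h1.hasDerivAt.hasDerivWithinAt hv
    have h4 : g t - g s = ∫ r in s..t, ‖deriv h r‖ :=
      intervalIntegral.integral_interval_sub_left hh't
        (hh't.mono_set (uIcc_subset_uIcc left_mem_uIcc
          (by rw [uIcc_of_le ht0.le]; exact Ioo_subset_Icc_self hs)))
    have h5 : s * (‖v‖ - g t + g s) ≤ s * ‖deriv x s‖ :=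
      mul_le_mul_of_nonneg_left (by linarith) hs.1.le
    linarith
  rw [intervalIntegral.integral_add (hj1.const_mul 2) hj2, intervalIntegral.integral_const_mul]
    at hle
  have hM0 : M 0 = 0 := by simp [hM]
  have hMt : M t = t ^ 2 * ‖v‖ := by simp only [hM]; ring
  rw [hM0, hMt, sub_zero] at hle
  -- Cauchy–Schwarz for the factors `√s` and `√s ‖x'‖`
  have hcs : ∫ s in 0..t, s * ‖deriv x s‖
      ≤ (t / √2) * √(∫ s in 0..t, s * ‖deriv x s‖ ^ 2) := by
    have hb : ∀ᵐ s ∂volume.restrict (Ioc 0 t), ‖√s‖ ≤ √t := by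
      filter_upwards [ae_restrict_mem measurableSet_Ioc] with s hs
      rw [Real.norm_of_nonneg (Real.sqrt_nonneg _)]
      exact Real.sqrt_le_sqrt hs.2
    have hms : AEStronglyMeasurable (fun s : ℝ => √s) (volume.restrict (Ioc 0 t)) :=
      Real.continuous_sqrt.aestronglyMeasurable
    have hf : MemLp (fun s : ℝ => √s) 2 (volume.restrict (Ioc 0 t)) :=
      MemLp.of_bound hms _ hb
    have hgm : MemLp (fun s => √s * ‖deriv x s‖) 2 (volume.restrict (Ioc 0 t)) :=
      hx2.norm.of_le_mul (c := √t) (hms.mul hx2.1.norm) <| by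
        filter_upwards [hb] with s hs
        rw [norm_mul]
        exact mul_le_mul_of_nonneg_right hs (norm_nonneg _)
    have h1 := integral_norm_mul_norm_le_sqrt hf hgm
    simp only [← intervalIntegral.integral_of_le ht0.le] at h1
    have e1 : ∫ s in 0..t, ‖√s‖ * ‖√s * ‖deriv x s‖‖ = ∫ s in 0..t, s * ‖deriv x s‖ := by
      refine intervalIntegral.integral_congr fun s hs => ?_
      rw [uIcc_of_le ht0.le] at hs
      rw [norm_mul, norm_norm, Real.norm_of_nonneg (Real.sqrt_nonneg _), ← mul_assoc,
        Real.mul_self_sqrt hs.1]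
    have e2 : ∫ s in 0..t, ‖√s‖ ^ 2 = t ^ 2 / 2 := by
      have : ∫ s in 0..t, ‖√s‖ ^ 2 = ∫ s in 0..t, s := by
        refine intervalIntegral.integral_congr fun s hs => ?_
        rw [uIcc_of_le ht0.le] at hs
        rw [Real.norm_of_nonneg (Real.sqrt_nonneg _), Real.sq_sqrt hs.1]
      rw [this, integral_id]
      ring
    have e3 : ∫ s in 0..t, ‖√s * ‖deriv x s‖‖ ^ 2 = ∫ s in 0..t, s * ‖deriv x s‖ ^ 2 := by
      refine intervalIntegral.integral_congr fun s hs => ?_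
      rw [uIcc_of_le ht0.le] at hs
      rw [norm_mul, norm_norm, mul_pow, Real.norm_of_nonneg (Real.sqrt_nonneg _),
        Real.sq_sqrt hs.1]
    rw [e1, e2, e3, Real.sqrt_div' _ zero_le_two, Real.sqrt_sq ht0.le] at h1
    exact h1
  set W := ∫ s in 0..t, s * ‖deriv x s‖ ^ 2
  set A := ∫ s in 0..t, s * ‖deriv h s‖ with hA
  set B := ‖x 0 - z‖ + ∫ s in 0..t, ‖h s‖ with hB
  have hA0 : 0 ≤ A := intervalIntegral.integral_nonneg ht0.le fun s hs =>
    mul_nonneg hs.1 (norm_nonneg _)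
  have hB0 : 0 ≤ B := add_nonneg (norm_nonneg _)
    (intervalIntegral.integral_nonneg ht0.le fun s _ => norm_nonneg _)
  have h2pos : 0 < √2 := by positivity
  have h22 : √2 * √2 = 2 := Real.mul_self_sqrt zero_le_two
  -- `√(2 W) ≤ ‖x 0 - z‖ + t ‖h t‖ + √2 √A √B`
  have hW : √2 * √W ≤ ‖x 0 - z‖ + t * ‖h t‖ + √2 * (√A * √B) := by
    have hn1 := norm_nonneg (x 0 - z)
    have hn2 : 0 ≤ t * ‖h t‖ := by positivity
    have hn3 : 0 ≤ √2 * (√A * √B) := by positivity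
    have hsq : (√2 * (√A * √B)) ^ 2 = 2 * (A * B) := by
      rw [mul_pow, mul_pow, Real.sq_sqrt zero_le_two, Real.sq_sqrt hA0, Real.sq_sqrt hB0]
    rw [← Real.sqrt_mul zero_le_two]
    refine Real.sqrt_le_iff.2 ⟨by positivity, ?_⟩
    nlinarith [mul_nonneg hn1 hn2, mul_nonneg hn1 hn3, mul_nonneg hn2 hn3]
  have hfin : t ^ 2 * ‖v‖ ≤ t * (‖x 0 - z‖ + t * ‖h t‖ + √2 * (√A * √B))
      + ∫ s in 0..t, s ^ 2 * ‖deriv h s‖ := by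
    have e : 2 * (t / √2 * √W) = t * (√2 * √W) := by
      field_simp
      linear_combination (-√W) * h22
    have := mul_le_mul_of_nonneg_left hW ht0.le
    linarith
  have hdiv : ‖v‖ ≤ (t * (‖x 0 - z‖ + t * ‖h t‖ + √2 * (√A * √B))
      + ∫ s in 0..t, s ^ 2 * ‖deriv h s‖) / t ^ 2 := by
    rw [le_div_iff₀ (by positivity)]
    linarith
  refine hdiv.trans (le_of_eq ?_)
  field_simp
  ring

end IsStrongSolution

end Smoothing

/-! ### The hypergraph energy and the Cauchy problem -/

section Hypergraph

variable {V : Type*}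

/-- The tangent line inequality for `r ↦ r ^ p` on `[0, ∞)`. At `r = 0` and `p = 1` it relies on
`0 ^ 0 = 1`. -/
theorem Real.rpow_sub_rpow_ge {p r s : ℝ} (hp : 1 ≤ p) (hr : 0 ≤ r) (hs : 0 ≤ s) :
    p * r ^ (p - 1) * (s - r) ≤ s ^ p - r ^ p := by
  rcases hr.eq_or_lt with rfl | hr
  · rcases hp.eq_or_lt with rfl | hp
    · simp
    · rw [Real.zero_rpow (by linarith), Real.zero_rpow (by linarith)]
      simpa using Real.rpow_nonneg hs p
  · have h1 := one_add_mul_self_le_rpow_one_add (s := s / r - 1)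
      (by linarith [div_nonneg hs hr.le]) hp
    rw [add_sub_cancel, Real.div_rpow hs hr.le, le_div_iff₀ (Real.rpow_pos_of_pos hr p)] at h1
    have h2 : r ^ p = r ^ (p - 1) * r := by
      rw [← Real.rpow_add_one hr.ne', sub_add_cancel]
    have h3 : (1 + p * (s / r - 1)) * r ^ p = r ^ p + p * r ^ (p - 1) * (s - r) := by
      rw [h2]
      field_simp
    linarith

variable [Fintype V]

theorem sub_le_edgeSpread {e : Finset V} {u v : V} (hu : u ∈ e) (hv : v ∈ e)
    (x : EuclideanSpace ℝ V) : x u - x v ≤ edgeSpread e x :=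
  le_ciSup (f := fun q : e × e => x q.1 - x q.2) (Set.finite_range _).bddAbove (⟨u, hu⟩, ⟨v, hv⟩)

theorem edgeSpread_nonneg (e : Finset V) (x : EuclideanSpace ℝ V) : 0 ≤ edgeSpread e x := by
  rcases e.eq_empty_or_nonempty with rfl | ⟨u, hu⟩
  · simp [edgeSpread]
  · simpa using sub_le_edgeSpread hu hu x

theorem exists_edgeSpread_eq {e : Finset V} (he : e.Nonempty) (x : EuclideanSpace ℝ V) :
    ∃ u ∈ e, ∃ v ∈ e, edgeSpread e x = x u - x v := by
  have : Nonempty (e × e) := ⟨⟨⟨_, he.choose_spec⟩, ⟨_, he.choose_spec⟩⟩⟩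
  obtain ⟨q, hq⟩ := exists_eq_ciSup_of_finite (f := fun q : e × e => x q.1 - x q.2)
  exact ⟨q.1, q.1.2, q.2, q.2.2, hq.symm⟩

theorem continuous_edgeSpread (e : Finset V) : Continuous (edgeSpread e) := by
  rcases e.eq_empty_or_nonempty with rfl | he
  · have : edgeSpread (∅ : Finset V) = fun _ => 0 := by
      funext x
      simp [edgeSpread]
    rw [this]
    exact continuous_const
  · have hne : (Finset.univ : Finset (e × e)).Nonempty :=
      ⟨⟨⟨_, he.choose_spec⟩, ⟨_, he.choose_spec⟩⟩, Finset.mem_univ _⟩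
    have : Nonempty (e × e) := ⟨hne.choose⟩
    have : edgeSpread e = fun x => Finset.univ.sup' hne fun q : e × e => x q.1 - x q.2 := by
      funext x
      rw [Finset.sup'_univ_eq_ciSup]
      rfl
    rw [this]
    exact Continuous.finset_sup'_apply hne fun q _ => by fun_prop

namespace WeightedHypergraph

variable (G : WeightedHypergraph V) {p : ℝ}

theorem energy_nonneg (hp : 1 ≤ p) (x : EuclideanSpace ℝ V) : 0 ≤ G.energy p x :=
  mul_nonneg (by positivity) <| Finset.sum_nonneg fun e _ =>
    mul_nonneg (G.weight_pos e).le (Real.rpow_nonneg (edgeSpread_nonneg _ _) _)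

theorem continuous_energy (hp : 1 ≤ p) : Continuous (G.energy p) :=
  continuous_const.mul <| continuous_finsetSum _ fun e _ => continuous_const.mul <|
    (continuous_edgeSpread _).rpow_const fun _ => Or.inr (by linarith)

/-- The hypergraph Laplacian is defined everywhere: a subgradient is the sum over the edges of
`w(e) f_e(x)^(p-1) (𝟙_u - 𝟙_v)`, where the pair `u, v` realises the maximum `f_e(x)`. -/
theorem pLaplacian_nonempty (hp : 1 ≤ p) (x : EuclideanSpace ℝ V) :
    (subdifferential (G.energy p) x).Nonempty := by
  classical
  have hp0 : 0 < p := by linarith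
  have hmax : ∀ e : G.edges, ∃ u ∈ (e : Finset V), ∃ v ∈ (e : Finset V),
      edgeSpread (e : Finset V) x = x u - x v := fun e =>
    exists_edgeSpread_eq (Finset.card_pos.1 (zero_lt_one.trans (G.one_lt_card e e.2))) x
  choose u hu v hv huv using hmax
  refine ⟨∑ e : G.edges, (G.weight e * edgeSpread (e : Finset V) x ^ (p - 1)) •
    (EuclideanSpace.single (u e) 1 - EuclideanSpace.single (v e) 1), fun ξ => ?_⟩
  simp only [sum_inner, energy, ← mul_sub, ← Finset.sum_sub_distrib, Finset.mul_sum]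
  refine Finset.sum_le_sum fun e _ => ?_
  rw [inner_smul_left, conj_trivial, inner_sub_left, EuclideanSpace.inner_single_left,
    EuclideanSpace.inner_single_left]
  simp only [map_one, one_mul, PiLp.sub_apply]
  set r := edgeSpread (e : Finset V) x with hr
  set s := edgeSpread (e : Finset V) ξ with hs
  have hr0 : 0 ≤ r := edgeSpread_nonneg _ _
  have h1 := Real.rpow_sub_rpow_ge hp hr0 (edgeSpread_nonneg (e : Finset V) ξ)
  rw [← hs] at h1
  have h2 : ξ (u e) - x (u e) - (ξ (v e) - x (v e)) ≤ s - r := by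
    have := sub_le_edgeSpread (hu e) (hv e) ξ
    have := huv e
    linarith
  have h3 : r ^ (p - 1) * (ξ (u e) - x (u e) - (ξ (v e) - x (v e))) ≤ 1 / p * (s ^ p - r ^ p) := by
    have h4 := mul_le_mul_of_nonneg_left h2 (Real.rpow_nonneg hr0 (p - 1))
    have h5 : r ^ (p - 1) * (s - r) ≤ 1 / p * (s ^ p - r ^ p) := by
      rw [one_div, le_inv_mul_iff₀ hp0]
      linarith
    linarith
  have h6 := mul_le_mul_of_nonneg_left h3 (G.weight_pos e).le
  linarith

theorem energy_average (hp : 1 ≤ p) (x : EuclideanSpace ℝ V) : G.energy p (G.average x) = 0 := by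
  have hsymm : ∀ e ∈ G.edges, ∀ u ∈ e, ∀ v ∈ e, G.component u = G.component v := by
    intro e he u hu v hv
    ext w
    simp only [component, Finset.mem_filter, Finset.mem_univ, true_and]
    exact ⟨fun h => Relation.ReflTransGen.head ⟨e, he, hv, hu⟩ h,
      fun h => Relation.ReflTransGen.head ⟨e, he, hu, hv⟩ h⟩
  have hzero : ∀ e ∈ G.edges, edgeSpread e (G.average x) = 0 := by
    intro e he
    obtain ⟨u, hu, v, hv, huv⟩ := exists_edgeSpread_eq
      (Finset.card_pos.1 (zero_lt_one.trans (G.one_lt_card e he))) (G.average x)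
    rw [huv]
    simp only [average, hsymm e he u hu v hv, sub_self]
  rw [energy, Finset.sum_eq_zero, mul_zero]
  intro e _
  rw [hzero e e.2, Real.zero_rpow (by linarith), mul_zero]

end WeightedHypergraph

end Hypergraph

theorem isRightLebesguePoint_of_continuousOn {H : Type*} [NormedAddCommGroup H] {h : ℝ → H}
    {T t₀ : ℝ} (hh : ContinuousOn h (Icc 0 T)) (ht₀ : t₀ ∈ Ico 0 T) :
    IsRightLebesguePoint h t₀ (h t₀) := by
  rw [IsRightLebesguePoint, Metric.tendsto_nhds]
  intro ε hε
  obtain ⟨δ, hδ, hhδ⟩ := Metric.continuousOn_iff.1 hh t₀ (Ico_subset_Icc_self ht₀) (ε / 2)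
    (half_pos hε)
  filter_upwards [Ioo_mem_nhdsGT (sub_pos.2 ht₀.2), Ioo_mem_nhdsGT hδ] with τ hτ hτδ
  have hle : t₀ ≤ t₀ + τ := by linarith [hτ.1]
  have h1 : ‖∫ s in t₀..(t₀ + τ), ‖h s - h t₀‖‖ ≤ ε / 2 * |t₀ + τ - t₀| := by
    refine intervalIntegral.norm_integral_le_of_norm_le_const fun s hs => ?_
    rw [uIoc_of_le hle] at hs
    rw [norm_norm, ← dist_eq_norm]
    refine (hhδ s ⟨ht₀.1.trans hs.1.le, by linarith [hs.2, hτ.2]⟩ ?_).le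
    rw [Real.dist_eq, abs_of_pos (sub_pos.2 hs.1)]
    linarith [hs.2, hτδ.2]
  rw [add_sub_cancel_left, abs_of_pos hτ.1] at h1
  rw [dist_zero_right, norm_mul, norm_div, norm_one, Real.norm_of_nonneg hτ.1.le,
    one_div, inv_mul_lt_iff₀ hτ.1]
  nlinarith [hτ.1]

theorem WeightedHypergraph.IsSolution.isStrongSolution {V : Type*} [Fintype V]
    {G : WeightedHypergraph V} {p T : ℝ} {h : ℝ → EuclideanSpace ℝ V} {x₀ : EuclideanSpace ℝ V}
    {x : ℝ → EuclideanSpace ℝ V} (hx : G.IsSolution p T h x₀ x) {a b : ℝ} (ha : 0 < a)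
    (hab : a < b) (hb : b < T) : IsStrongSolution (G.energy p) a b h x where
  absolutelyContinuous := hx.absolutelyContinuous a b ha hab hb
  inclusion := ae_restrict_Ioo_mono ha.le hb.le hx.inclusion

/-- Uniqueness: the distance of two solutions is nonincreasing in the interior of the interval, and
continuous up to its end points. -/
theorem WeightedHypergraph.IsSolution.eqOn {V : Type*} [Fintype V]
    {G : WeightedHypergraph V} {p T : ℝ} {h : ℝ → EuclideanSpace ℝ V} {x₀ : EuclideanSpace ℝ V}
    {x y : ℝ → EuclideanSpace ℝ V} (hx : G.IsSolution p T h x₀ x) (hy : G.IsSolution p T h x₀ y)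
    (hT : 0 < T) : EqOn x y (Icc 0 T) := by
  have hc : ContinuousOn (fun t => ‖x t - y t‖) (Icc 0 T) :=
    (hx.continuousOn.sub hy.continuousOn).norm
  have hanti : ∀ a ∈ Ioo 0 T, ∀ b ∈ Ioo 0 T, a < b → ‖x b - y b‖ ≤ ‖x a - y a‖ := by
    intro a ha b hb hab
    have := (hx.isStrongSolution ha.1 hab hb.2).norm_sub_le hab.le
      (hy.isStrongSolution ha.1 hab hb.2) (by simp)
    simpa using this
  have h0 : Tendsto (fun t => ‖x t - y t‖) (𝓝[>] 0) (𝓝 0) := by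
    have h1 := (hc 0 ⟨le_rfl, hT.le⟩).tendsto
    simp only [hx.initial, hy.initial, sub_self, norm_zero] at h1
    refine h1.mono_left (nhdsWithin_le_of_mem ?_)
    filter_upwards [Ioo_mem_nhdsGT hT] with t ht using Ioo_subset_Icc_self ht
  have hint : ∀ t ∈ Ioo 0 T, ‖x t - y t‖ ≤ 0 := by
    intro t ht
    refine ge_of_tendsto h0 ?_
    filter_upwards [Ioo_mem_nhdsGT ht.1] with s hs
    exact hanti s ⟨hs.1, hs.2.trans ht.2⟩ t ht hs.2
  have hcl : Icc 0 T ⊆ closure (Ioo 0 T) := by rw [closure_Ioo hT.ne]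
  intro t ht
  have := EqOn.of_subset_closure (f := x) (g := y) (s := Ioo 0 T) (t := Icc 0 T)
    (fun s hs => sub_eq_zero.1 (norm_le_zero_iff.1 (hint s hs))) hx.continuousOn hy.continuousOn
    Ioo_subset_Icc_self hcl
  exact this ht

theorem theorem3p1 {V : Type*} [Fintype V] (G : WeightedHypergraph V) (p : ℝ) (hp : 1 ≤ p)
    (T : ℝ) (hT : 0 < T) (x₀ : EuclideanSpace ℝ V) (h : ℝ → EuclideanSpace ℝ V)
    (hh : MemLp h 2 (volume.restrict (Ioo 0 T))) :
    ∃ x : ℝ → EuclideanSpace ℝ V,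
      G.IsSolution p T h x₀ x ∧
      (∀ y : ℝ → EuclideanSpace ℝ V, G.IsSolution p T h x₀ y → EqOn y x (Icc 0 T)) ∧
      MemW1 2 T x ∧
      AbsolutelyContinuousOnInterval (fun t => G.energy p (x t)) 0 T ∧
      (∀ t ∈ Icc 0 T,
        Real.sqrt (∫ s in (0 : ℝ)..t, ‖deriv x s‖ ^ 2) ≤
          Real.sqrt (∫ s in (0 : ℝ)..t, ‖h s‖ ^ 2) + Real.sqrt (G.energy p x₀)) ∧
      (∀ t₀ ∈ Ico 0 T, ∀ l : EuclideanSpace ℝ V, IsRightLebesguePoint h t₀ l →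
        Tendsto (fun τ : ℝ => (1 / τ) • ∫ s in t₀..(t₀ + τ), h s) (𝓝[>] 0) (𝓝 l) ∧
        ∃ z : EuclideanSpace ℝ V,
          IsMinimalElement ((fun y => l - y) '' G.pLaplacian p (x t₀)) z ∧
          HasDerivWithinAt x z (Ici t₀) t₀) ∧
      (MemW1 1 T h →
        MemLp (fun t => t • deriv x t) ∞ (volume.restrict (Ioo 0 T)) ∧
        ∀ t ∈ Ioo 0 T, ∃ z : EuclideanSpace ℝ V,
          HasDerivWithinAt x z (Ici t) t ∧
          ‖z‖ ≤ ‖h t‖ + (1 / t) * ‖x₀ - G.average x₀‖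
            + (1 / t ^ 2) * (∫ s in (0 : ℝ)..t, s ^ 2 * ‖deriv h s‖)
            + (Real.sqrt 2 / t) * Real.sqrt (∫ s in (0 : ℝ)..t, s * ‖deriv h s‖)
              * Real.sqrt (‖x₀ - G.average x₀‖ + ∫ s in (0 : ℝ)..t, ‖h s‖)) := by
  have hφ := G.continuous_energy hp
  have hφ0 := G.energy_nonneg hp
  have hne := G.pLaplacian_nonempty hp
  have hz := G.energy_average hp x₀
  have hhi : IntervalIntegrable h volume 0 T := by
    rw [intervalIntegrable_iff_integrableOn_Ioo_of_le hT.le]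
    exact hh.integrable one_le_two
  obtain ⟨y, L, hy0, hylip, hxy⟩ := exists_weakInclusion (z := G.average x₀) hφ
    (fun x => hz.le.trans (hφ0 x)) hne hT hhi x₀
  obtain ⟨x, hx⟩ : ∃ x : ℝ → EuclideanSpace ℝ V, x = fun t => x₀ + (∫ s in 0..t, h s) + y t :=
    ⟨_, rfl⟩
  rw [← hx] at hxy
  have hsol := hxy.isStrongSolution hT hx hylip hhi
  have hae := hxy.ae_hasDerivAt hT hx hylip hhi
  have hx0 : x 0 = x₀ := by simp [hx, hy0]
  have hxc : ContinuousOn x (Icc 0 T) := by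
    simpa [uIcc_of_le hT.le] using hsol.absolutelyContinuous.continuousOn
  have hxS : G.IsSolution p T h x₀ x :=
    { continuousOn := hxc
      absolutelyContinuous := fun a b ha hab hb =>
        (hsol.mono ha.le hab.le hb.le).absolutelyContinuous
      inclusion := hsol.inclusion
      initial := hx0 }
  have hmeas : AEStronglyMeasurable (deriv x) (volume.restrict (Ioo 0 T)) :=
    (stronglyMeasurable_deriv x).aestronglyMeasurable
  have hx' : MemLp (deriv x) 2 (volume.restrict (Ioo 0 T)) := by
    refine (hh.norm.add (memLp_const (L : ℝ))).of_le hmeas ?_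
    filter_upwards [hae] with t ⟨v, hvL, hv, _⟩
    rw [hv.deriv]
    exact (norm_sub_le _ _).trans ((add_le_add_right hvL _).trans (le_abs_self _))
  have hright : ∀ t₀ ∈ Ico 0 T, ∀ l : EuclideanSpace ℝ V, IsRightLebesguePoint h t₀ l →
      ∃ z : EuclideanSpace ℝ V, IsMinimalElement ((fun y => l - y) '' G.pLaplacian p (x t₀)) z ∧
        HasDerivWithinAt x z (Ici t₀) t₀ := fun t₀ ht₀ l hl =>
    hxy.exists_hasDerivWithinAt hT hne hx hylip hhi ht₀ hl
  refine ⟨x, hxS, fun y hy => hy.eqOn hxS hT, ⟨hsol.absolutelyContinuous, ?_, hx'⟩,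
    hsol.absolutelyContinuousOnInterval_comp hφ hne, fun t ht => ?_,
    fun t₀ ht₀ l hl => ⟨hl.tendsto_average hhi ht₀, hright t₀ ht₀ l hl⟩, fun hW => ⟨?_, ?_⟩⟩
  · obtain ⟨C, hC⟩ := isCompact_Icc.exists_bound_of_continuousOn hxc
    refine MemLp.of_bound ((hxc.mono Ioo_subset_Icc_self).aestronglyMeasurable
      measurableSet_Ioo) C ?_
    filter_upwards [ae_restrict_mem measurableSet_Ioo] with t ht
      using hC t (Ioo_subset_Icc_self ht)
  · have := hsol.sqrt_integral_norm_deriv_sq_le hφ hφ0 hne hh hx' ht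
    rwa [hx0] at this
  · -- `x' = h + y'`, where `h` is bounded by continuity and `y` is Lipschitz
    obtain ⟨C, hC⟩ := hW.absolutelyContinuous.exists_bound
    rw [uIcc_of_le hT.le] at hC
    refine memLp_top_of_bound (continuous_id.aestronglyMeasurable.smul hmeas) (T * (C + L)) ?_
    filter_upwards [hae, ae_restrict_mem measurableSet_Ioo] with t ⟨v, hvL, hv, _⟩ ht
    have h1 : ‖deriv x t‖ ≤ C + L := by
      rw [hv.deriv]
      exact (norm_sub_le _ _).trans (add_le_add (hC t (Ioo_subset_Icc_self ht)) hvL)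
    rw [norm_smul, Real.norm_of_nonneg ht.1.le]
    exact mul_le_mul ht.2.le h1 (norm_nonneg _) hT.le
  · intro t ht
    have hhc : ContinuousOn h (Icc 0 T) := by
      simpa [uIcc_of_le hT.le] using hW.absolutelyContinuous.continuousOn
    obtain ⟨z, _, hv⟩ := hright t (Ioo_subset_Ico_self ht) (h t)
      (isRightLebesguePoint_of_continuousOn hhc (Ioo_subset_Ico_self ht))
    have hh' : IntervalIntegrable (fun s => ‖deriv h s‖) volume 0 T := by
      rw [intervalIntegrable_iff_integrableOn_Ioo_of_le hT.le]
      exact (hW.memLp_deriv.integrable le_rfl).norm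
    have := hsol.norm_rightDeriv_le_smoothing hφ hφ0 hz hne hW.absolutelyContinuous hh' hx' ht hv
    rw [hx0] at this
    exact ⟨z, hv, this⟩
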